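/- Let $p,d$ be positive integers, $\alpha>0$, $\|\cdot\|$ a norm on $\mathbb{R}^d$, and let $C$ be the space of continuous functions $f:\mathbb{R}^p\to[0,\infty)^d$ with the $\sigma$-field $\mathcal{C}$ generated by the projections $f\mapsto f(t)$. For $\beta\ge 0$ let $E_\beta$ be the class of measurable maps $H:C\to[0,\infty]$ with $H(cf)=c^\beta H(f)$ for all $c>0$, $f\in C$. For a random process $Z$ with sample paths in $C$, the max-stable process associated with $Z$ is $$\max_{i\ge1}\Gamma_i^{-1/\alpha}Z^{(i)}(t),\qquad t\in\mathbb{R}^p,$$ where the maximum is taken componentwise, $\Gamma_i=E_1+\dots+E_i$ with independent unit exponential random variables $E_k$, and the $Z^{(i)}$ are independent copies of $Z$, independent of the $E_k$. If a process $X$ with sample paths in $C$ is equal in law (in the sense of finite-dimensional distributions) to this process, then $Z$ is called a spectral process of $X$. Let $Z$ be a random process with sample paths in $C$ such that $\mathbb{E}\|Z(t)\|^\alpha=1$ for all $t\in\mathbb{R}^p$, and let $\widetilde Z$ be a random process with sample paths in $C$. (i) Suppose that $Z$ and $\widetilde Z$ are spectral processes of the same process $X$ with sample paths in $C$, and that $\mathbb{P}(\sup_t\|Z(t)\|>0)=\mathbb{P}(\sup_t\|\widetilde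 Z(t)\|>0)=1$. Then $\mathbb{E}[H(Z)]=\mathbb{E}[H(\widetilde Z)]$ for all $H\in E_\alpha$. Conversely, suppose that $\mathbb{E}\|\widetilde Z(h)\|^\alpha=1$ for all $h\in\mathbb{R}^p$ and that $$\mathbb{E}\big[\|Z(h)\|^\alpha\,\Gamma(Z)\big]=\mathbb{E}\big[\|\widetilde Z(h)\|^\alpha\,\Gamma(\widetilde Z)\big]\qquad\text{for all }\Gamma\in E_0,\ h\in\mathbb{R}^p.$$ Then the max-stable processes associated with $Z$ and $\widetilde Z$ are equal in law (they have the same finite-dimensional distributions). In particular, if $X$ and $\widetilde X$ are processes with sample paths in $C$ that have $Z$ and $\widetilde Z$, respectively, as spectral processes, then $X$ and $\widetilde X$ have the same law on $(C,\mathcal{C})$. (ii) Suppose that $Z$ is a spectral process of the process $X$ with sample paths in $C$ and that $\mathbb{P}(\sup_t\|Z(t)\|>0)=1$. For $h\in\mathbb{R}^p$ let $\Theta^{[h]}$ be a random process with sample paths in $C$ and law $$\mathbb{P}(\Theta^{[h]}\in A)=\frac{1}{\mathbb{E}\|Z(h)\|^\alpha}\,\mathbb{E}\Big[\|Z(h)\|^\alpha\,\mathbb{1}\big(Z/\|Z(h)\|\in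 A\big)\Big],\qquad A\in\mathcal{C},$$ and let $W$ be a $\mathbb{Q}^p$-valued random variable, defined on the same probability space as the family $(\Theta^{[h]})_h$ and independent of it, with probability mass function $q(s)>0$, $s\in\mathbb{Q}^p$. Then almost surely $0<\sum_{s\in\mathbb{Q}^p}\|\Theta^{[W]}(s)\|^\alpha q(s)<\infty$, and $$Z_W(t)=\frac{1}{\big(\sum_{s\in\mathbb{Q}^p}\|\Theta^{[W]}(s)\|^\alpha q(s)\big)^{1/\alpha}}\;\Theta^{[W]}(t),\qquad t\in\mathbb{R}^p,$$ is a spectral process of $X$. -/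

import Mathlib

open MeasureTheory ProbabilityTheory
open scoped NNReal ENNReal

noncomputable section

/-- The space `C` of continuous functions `f : ℝ^p → [0, ∞)^d`. -/
abbrev PathSpace (p d : ℕ) : Type := C(Fin p → ℝ, Fin d → ℝ≥0)

/-- The `σ`-field on `C` generated by the projections `f ↦ f t`. -/
instance PathSpace.instMeasurableSpace (p d : ℕ) : MeasurableSpace (PathSpace p d) :=
  ⨆ t : Fin p → ℝ, MeasurableSpace.comap (fun f : PathSpace p d => f t) inferInstance

theorem PathSpace.measurable_eval {p d : ℕ} (t : Fin p → ℝ) :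
    Measurable (fun f : PathSpace p d => f t) :=
  Measurable.of_comap_le
    (le_iSup (fun t : Fin p → ℝ =>
      MeasurableSpace.comap (fun f : PathSpace p d => f t) inferInstance) t)

theorem PathSpace.measurable_of_eval {p d : ℕ} {Ω : Type*} [MeasurableSpace Ω]
    {Z : Ω → PathSpace p d} (h : ∀ t, Measurable fun ω => Z ω t) : Measurable Z := by
  refine Measurable.of_le_map (iSup_le fun t => ?_)
  rw [MeasurableSpace.comap_le_iff_le_map]
  exact h t

/-- A rational point `s ∈ ℚ^p`, seen in `ℝ^p`. -/
def ratPoint {p : ℕ} (s : Fin p → ℚ) : Fin p → ℝ := fun i => (s i : ℝ)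

/-- `‖f(t)‖`, where the norm `N` on `ℝ^d` is given as a seminorm
(assumed definite wherever it is used). -/
def normAt {p d : ℕ} (N : Seminorm ℝ (Fin d → ℝ)) (f : PathSpace p d) (t : Fin p → ℝ) : ℝ≥0 :=
  ⟨N (fun j => (f t j : ℝ)), apply_nonneg N _⟩

/-- The class `E_β` of measurable `β`-homogeneous maps `H : C → [0, ∞]`. -/
structure IsHomogeneousFunctional {p d : ℕ} (β : ℝ) (H : PathSpace p d → ℝ≥0∞) : Prop where
  measurable : Measurable H
  map_smul : ∀ c : ℝ≥0, 0 < c → ∀ f : PathSpace p d, H (c • f) = (c : ℝ≥0∞) ^ β * H f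

/-- The field `(t, j) ↦ max_{i ≥ 1} Γ_i ^ (-1/α) Z^{(i)}_j(t)` with `Γ_i = E_1 + ⋯ + E_i`,
as a function of the values `e` of the `E_k` and `z` of the `Z^{(i)}` (both indexed from `0`). -/
def deHaanMax {p d : ℕ} (α : ℝ) (x : (ℕ → ℝ) × (ℕ → PathSpace p d))
    (t : Fin p → ℝ) (j : Fin d) : ℝ≥0∞ :=
  ⨆ i : ℕ, ENNReal.ofReal ((∑ k ∈ Finset.range (i + 1), x.1 k) ^ (-1 / α)) * (x.2 i t j : ℝ≥0∞)

theorem measurable_deHaanMax {p d : ℕ} (α : ℝ) :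
    Measurable (deHaanMax (p := p) (d := d) α) := by
  refine measurable_pi_lambda _ fun t => measurable_pi_lambda _ fun j => ?_
  refine Measurable.iSup fun i => ?_
  have h1 : Measurable fun x : (ℕ → ℝ) × (ℕ → PathSpace p d) =>
      ENNReal.ofReal ((∑ k ∈ Finset.range (i + 1), x.1 k) ^ (-1 / α)) := by
    refine ENNReal.measurable_ofReal.comp (Measurable.pow_const ?_ _)
    exact Finset.measurable_sum _ fun k _ => (measurable_pi_apply k).comp measurable_fst
  have h2 : Measurable fun x : (ℕ → ℝ) × (ℕ → PathSpace p d) => (x.2 i t j : ℝ≥0∞) := by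
    refine measurable_coe_nnreal_ennreal.comp ((measurable_pi_apply j).comp ?_)
    exact (PathSpace.measurable_eval t).comp ((measurable_pi_apply i).comp measurable_snd)
  exact h1.mul h2

/-- The law of the field `max_{i ≥ 1} Γ_i ^ (-1/α) Z^{(i)}`, where the `E_k` are independent unit
exponentials, the `Z^{(i)}` are independent with law `ν`, and the two sequences are independent.
It is a measure on the product space of all `[0, ∞]^d`-valued functions on `ℝ^p`, so that
equality of two such laws is equality of all finite-dimensional distributions. -/
def deHaanLaw {p d : ℕ} (α : ℝ) (ν : Measure (PathSpace p d)) :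
    Measure ((Fin p → ℝ) → Fin d → ℝ≥0∞) :=
  ((Measure.infinitePi fun _ : ℕ => expMeasure 1).prod
    (Measure.infinitePi fun _ : ℕ => ν)).map (deHaanMax α)

/-- `Z` is a spectral process of the process `X`: both have sample paths in `C`, and in
distribution `X = max_{i ≥ 1} Γ_i ^ (-1/α) Z^{(i)}`. -/
structure IsSpectralProcess {p d : ℕ} (α : ℝ)
    {Ω : Type*} [MeasurableSpace Ω] (P : Measure Ω) (Z : Ω → PathSpace p d)
    {Ω' : Type*} [MeasurableSpace Ω'] (P' : Measure Ω') (X : Ω' → PathSpace p d) : Prop where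
  measurable_spectral : Measurable Z
  measurable_process : Measurable X
  law_eq : P'.map (fun ω t j => (X ω t j : ℝ≥0∞)) = deHaanLaw α (P.map Z)

/-- `P(sup_t ‖Z(t)‖ > 0) = 1`. -/
def IsNonvanishing {p d : ℕ} (N : Seminorm ℝ (Fin d → ℝ))
    {Ω : Type*} [MeasurableSpace Ω] (P : Measure Ω) (Z : Ω → PathSpace p d) : Prop :=
  ∀ᵐ ω ∂P, 0 < ⨆ t : Fin p → ℝ, (normAt N (Z ω) t : ℝ≥0∞)

/-- `E[‖Z(t)‖^α] = 1` for all `t`. -/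
def HasUnitMoments {p d : ℕ} (N : Seminorm ℝ (Fin d → ℝ)) (α : ℝ)
    {Ω : Type*} [MeasurableSpace Ω] (P : Measure Ω) (Z : Ω → PathSpace p d) : Prop :=
  ∀ t : Fin p → ℝ, ∫⁻ ω, (normAt N (Z ω) t : ℝ≥0∞) ^ α ∂P = 1

/-- `Y` is a version of the tilted process `Θ^{[h]}` of `Z`:
`P(Θ^{[h]} ∈ A) = E[‖Z(h)‖^α 𝟙(Z / ‖Z(h)‖ ∈ A)] / E[‖Z(h)‖^α]`. -/
structure IsTiltedProcess {p d : ℕ} (N : Seminorm ℝ (Fin d → ℝ)) (α : ℝ) (h : Fin p → ℝ)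
    {Ω : Type*} [MeasurableSpace Ω] (P : Measure Ω) (Z : Ω → PathSpace p d)
    {Ω' : Type*} [MeasurableSpace Ω'] (P' : Measure Ω') (Y : Ω' → PathSpace p d) : Prop where
  measurable : Measurable Y
  law : ∀ A : Set (PathSpace p d), MeasurableSet A →
    P' (Y ⁻¹' A) = (∫⁻ ω, (normAt N (Z ω) h : ℝ≥0∞) ^ α ∂P)⁻¹ *
      ∫⁻ ω, (normAt N (Z ω) h : ℝ≥0∞) ^ α *
        A.indicator (fun _ => (1 : ℝ≥0∞)) ((normAt N (Z ω) h)⁻¹ • Z ω) ∂P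

/-- `∑_{s ∈ ℚ^p} ‖f(s)‖^α q(s)`. -/
def weightedSum {p d : ℕ} (N : Seminorm ℝ (Fin d → ℝ)) (α : ℝ) (q : PMF (Fin p → ℚ))
    (f : PathSpace p d) : ℝ≥0∞ :=
  ∑' s : Fin p → ℚ, (normAt N f (ratPoint s) : ℝ≥0∞) ^ α * q s

/-- `f / (∑_{s ∈ ℚ^p} ‖f(s)‖^α q(s))^{1/α}`
(with the irrelevant value `0` when the sum is `0` or `∞`). -/
def normalisedPath {p d : ℕ} (N : Seminorm ℝ (Fin d → ℝ)) (α : ℝ) (q : PMF (Fin p → ℚ))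
    (f : PathSpace p d) : PathSpace p d :=
  ((weightedSum N α q f).toNNReal ^ (1 / α))⁻¹ • f

end

/-! Everything rests on the exponent `scaledSup α x f`, the maximum of (f_j(t) / x_j(t))^α, for
positive levels `x` that are finite at only finitely many points t. The max-stable field lies below
`x` exactly when no pair (Γ_i, Z^(i)) satisfies Γ_i < `scaledSup α x` (Z^(i)). By the Poisson
avoidance formula `expSeqProd_forall_le` this has probability exp(-E[`scaledSup α x` (Z)]), so two
max-stable laws agree iff the exponents have equal expectations (`deHaanLaw_eq_iff`). The avoidance
formula itself comes from conditioning on the first arrival: this gives a renewal equation with an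
explicit and unique solution.

For the direct part of (i), exponent integrals must determine E[H] for every H in E_α. With Y =
f_j(t)^α, the maximum of an exponent and cY is again an exponent. The right derivative of its
expectation at c = 1 is E[Y; `scaledSup α x` ≤ Y], which is the distribution function of f / f_j(t)
under the density f_j(t)^α. Hence these tilted laws agree (`tiltedLaw_coord_eq`), and by homogeneity
so do the integrals of H over the cones {f_j(t) > 0}. A nonzero continuous path lies in such a cone
for some rational t, so disjointifying countably many cones recovers E[H]
(`lintegral_eq_of_forall_cone`).

For the converse, H / ‖f(t)‖^α lies in E_0 when H is an exponent, so the hypothesis gives its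
integral over {‖f(t)‖ > 0}; the finitely many t where the level is finite cover the support of H.

For (ii), let S be the weighted sum over ℚ^p. Splitting according to W gives E[H(Z_W)] = ∑ q(s)
E[‖Z(s)‖^α H(Z / S(Z)^(1/α))] = E[S(Z) H(Z / S(Z)^(1/α))] = E[H(Z)] for H in E_α. Taking exponents
for H identifies the max-stable law. -/

/-! ### The renewal equation for exponential arrivals -/

open Set Filter Topology in
/-- If `A` is the primitive of a right-continuous distribution function `F` which equals `1` from
`M` on, then `exp (-A)` is minus the primitive of `F * exp (-A)` vanishing at infinity. -/
theorem integral_Ioi_mul_exp_neg_primitive {F : ℝ → ℝ} (hmono : Monotone F) (h0 : ∀ u, 0 ≤ F u)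
    (hrc : ∀ u, ContinuousWithinAt F (Ici u) u) {M : ℝ} (hM : ∀ u, M ≤ u → F u = 1) (c : ℝ) :
    ∫ u in Ioi c, F u * Real.exp (-∫ v in (0 : ℝ)..u, F v) =
      Real.exp (-∫ v in (0 : ℝ)..c, F v) := by
  have hint : ∀ a b, IntervalIntegrable F volume a b := fun a b => hmono.intervalIntegrable
  set A : ℝ → ℝ := fun u => ∫ v in (0 : ℝ)..u, F v with hA
  have hAc : Continuous A := intervalIntegral.continuous_primitive hint 0
  -- `F` may jump, so only a right derivative is available; together with continuity of `A` it
  -- suffices for the fundamental theorem of calculus.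
  have hAd : ∀ u, HasDerivWithinAt A (F u) (Ioi u) u := fun u =>
    (intervalIntegral.integral_hasDerivWithinAt_right (s := Ici u) (t := Ioi u) (hint 0 u)
      (hmono.measurable.stronglyMeasurable.stronglyMeasurableAtFilter)
      ((hrc u).mono Ioi_subset_Ici_self)).mono Ioi_subset_Ici_self
  have hderiv : ∀ u, HasDerivWithinAt (fun u => -Real.exp (-A u)) (F u * Real.exp (-A u))
      (Ioi u) u := by
    intro u
    have := ((hAd u).neg.exp).neg
    refine this.congr_deriv ?_
    simp; ring
  have hmeas : Measurable fun u => F u * Real.exp (-A u) :=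
    hmono.measurable.mul (Real.measurable_exp.comp hAc.measurable.neg)
  have hlin : ∀ u, M ≤ u → A u = A M + (u - M) := by
    intro u hu
    have h1 : A u = A M + ∫ v in M..u, F v :=
      (intervalIntegral.integral_add_adjacent_intervals (hint 0 M) (hint M u)).symm
    rw [h1, intervalIntegral.integral_congr (g := fun _ => (1 : ℝ))]
    · simp
    · intro v hv
      rw [uIcc_of_le hu] at hv
      exact hM v hv.1
  have hII : ∀ a b, a ≤ b → ∫ u in a..b, F u * Real.exp (-A u) =
      Real.exp (-A a) - Real.exp (-A b) := by
    intro a b hab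
    rw [intervalIntegral.integral_eq_sub_of_hasDeriv_right_of_le hab
      (f := fun u => -Real.exp (-A u))
      (by fun_prop) (fun u _ => hderiv u)]
    · ring
    · exact (hint a b).mul_continuousOn (by fun_prop)
  have hlim : Tendsto (fun b => Real.exp (-A b)) atTop (𝓝 0) := by
    refine Real.tendsto_exp_neg_atTop_nhds_zero.comp ?_
    have : Tendsto (fun u : ℝ => A M + (u - M)) atTop atTop :=
      tendsto_atTop_add_const_left _ _ (tendsto_atTop_add_const_right _ _ tendsto_id)
    refine this.congr' ?_
    filter_upwards [eventually_ge_atTop M] with u hu using (hlin u hu).symm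
  have hlim2 : Tendsto (fun b => ∫ u in c..b, F u * Real.exp (-A u)) atTop
      (𝓝 (Real.exp (-A c))) := by
    have h2 : Tendsto (fun b => Real.exp (-A c) - Real.exp (-A b)) atTop
        (𝓝 (Real.exp (-A c) - 0)) := hlim.const_sub _
    rw [sub_zero] at h2
    refine h2.congr' ?_
    filter_upwards [eventually_ge_atTop c] with b hb using (hII c b hb).symm
  have hloc : ∀ b, IntegrableOn (fun u => F u * Real.exp (-A u)) (Ioc c b) := fun b =>
    ((hint c b).mul_continuousOn (by fun_prop)).1
  have hon : IntegrableOn (fun u => F u * Real.exp (-A u)) (Ioi c) := by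
    refine integrableOn_Ioi_of_intervalIntegral_norm_tendsto (Real.exp (-A c)) c
      (b := id) (l := atTop) (fun b => hloc b) tendsto_id ?_
    refine hlim2.congr fun b => ?_
    refine intervalIntegral.integral_congr fun u _ => ?_
    simp only [Real.norm_eq_abs]
    rw [abs_of_nonneg (mul_nonneg (h0 u) (Real.exp_pos _).le)]
  exact tendsto_nhds_unique (intervalIntegral_tendsto_integral_Ioi c hon tendsto_id) hlim2

theorem measurable_exponentialPDF (r : ℝ) : Measurable (exponentialPDF r) :=
  ENNReal.measurable_ofReal.comp (measurable_exponentialPDFReal r)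

open Set in
theorem integral_expMeasure_one (f : ℝ → ℝ) :
    ∫ s, f s ∂expMeasure 1 = ∫ s in Ioi 0, Real.exp (-s) * f s := by
  have hm : expMeasure 1 = volume.withDensity (exponentialPDF 1) := rfl
  rw [hm, integral_withDensity_eq_integral_toReal_smul
    (measurable_exponentialPDF 1)
    (by simp [exponentialPDF]), ← integral_Ici_eq_integral_Ioi,
    ← integral_indicator measurableSet_Ici]
  congr 1 with s
  by_cases hs : 0 ≤ s
  · rw [exponentialPDF_of_nonneg hs, indicator_of_mem (mem_Ici.2 hs),
      ENNReal.toReal_ofReal (by positivity)]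
    simp
  · rw [exponentialPDF_of_neg (not_le.1 hs), indicator_of_notMem (by simpa using hs)]
    simp

theorem ae_expMeasure_one_pos : ∀ᵐ s ∂expMeasure 1, 0 < s := by
  have hm : expMeasure 1 = volume.withDensity (exponentialPDF 1) := rfl
  rw [hm, ae_withDensity_iff (measurable_exponentialPDF 1)]
  filter_upwards [Measure.ae_ne volume (0 : ℝ)] with s hs h
  by_contra h0
  exact h (exponentialPDF_of_neg (lt_of_le_of_ne (not_lt.1 h0) hs))

/-- This mass is the contraction factor in the uniqueness argument for the renewal equation. -/
theorem expMeasure_one_real_Iic_lt_one (M : ℝ) : (expMeasure 1).real (Set.Iic M) < 1 := by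
  have := isProbabilityMeasure_expMeasure one_pos
  rw [← cdf_eq_real, cdf_expMeasure_eq one_pos]
  split_ifs
  · have := Real.exp_pos (-(1 * M))
    linarith
  · exact one_pos

/-- Uniqueness for the renewal equation `G c = E[F (c + E) * G (c + E)]`, `E` exponential. -/
theorem renewal_unique {F G G' : ℝ → ℝ} (hFm : Measurable F) (hGm : Measurable G)
    (hGm' : Measurable G') (hF0 : ∀ u, 0 ≤ F u) (hF1 : ∀ u, F u ≤ 1)
    (hG0 : ∀ u, 0 ≤ G u) (hG1 : ∀ u, G u ≤ 1) (hG0' : ∀ u, 0 ≤ u → 0 ≤ G' u)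
    (hG1' : ∀ u, 0 ≤ u → G' u ≤ 1) {M : ℝ} (hM : ∀ u, M ≤ u → G u = G' u)
    (hG : ∀ c, 0 ≤ c → G c = ∫ s, F (c + s) * G (c + s) ∂expMeasure 1)
    (hG' : ∀ c, 0 ≤ c → G' c = ∫ s, F (c + s) * G' (c + s) ∂expMeasure 1) {c : ℝ} (hc : 0 ≤ c) :
    G c = G' c := by
  have := isProbabilityMeasure_expMeasure one_pos
  set r := (expMeasure 1).real (Set.Iic M) with hr
  have hr1 : r < 1 := expMeasure_one_real_Iic_lt_one M
  have hr0 : 0 ≤ r := measureReal_nonneg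
  have hint : ∀ g : ℝ → ℝ, Measurable g → (∀ u, 0 ≤ u → 0 ≤ g u) → (∀ u, 0 ≤ u → g u ≤ 1) →
      ∀ c, 0 ≤ c → Integrable (fun s => F (c + s) * g (c + s)) (expMeasure 1) := by
    intro g hg h0 h1 c hc
    refine Integrable.of_bound (C := 1) (by fun_prop) ?_
    filter_upwards [ae_expMeasure_one_pos] with s hs
    have hcs : 0 ≤ c + s := by linarith
    rw [Real.norm_eq_abs, abs_of_nonneg (mul_nonneg (hF0 _) (h0 _ hcs))]
    exact mul_le_one₀ (hF1 _) (h0 _ hcs) (h1 _ hcs)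
  -- The two solutions agree from `M` on, so only arrivals with s ≤ M contribute to the difference.
  -- Each use of the equation thus gains a factor `r` < 1.
  have key : ∀ n : ℕ, ∀ c, 0 ≤ c → |G c - G' c| ≤ r ^ n := by
    intro n
    induction n with
    | zero =>
      intro c hc
      rw [pow_zero, abs_le]
      constructor <;> linarith [hG0 c, hG1 c, hG0' c hc, hG1' c hc]
    | succ n ih =>
      intro c hc
      rw [hG c hc, hG' c hc, ← integral_sub (hint G hGm (fun u _ => hG0 u) (fun u _ => hG1 u) c hc)
        (hint G' hGm' hG0' hG1' c hc)]
      have hb : ∀ᵐ s ∂expMeasure 1, ‖F (c + s) * G (c + s) - F (c + s) * G' (c + s)‖ ≤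
          (Set.Iic M).indicator (fun _ => r ^ n) s := by
        filter_upwards [ae_expMeasure_one_pos] with s hs
        have hcs : 0 ≤ c + s := by linarith
        rw [← mul_sub, Real.norm_eq_abs, abs_mul, abs_of_nonneg (hF0 _)]
        by_cases hsM : s ≤ M
        · rw [Set.indicator_of_mem (Set.mem_Iic.2 hsM)]
          calc F (c + s) * |G (c + s) - G' (c + s)| ≤ 1 * |G (c + s) - G' (c + s)| := by
                gcongr; exact hF1 _
            _ ≤ r ^ n := by rw [one_mul]; exact ih _ hcs
        · rw [hM (c + s) (by linarith), Set.indicator_of_notMem (by simpa using hsM)]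
          simp
      have := norm_integral_le_of_norm_le
        ((integrable_const (r ^ n)).indicator measurableSet_Iic) hb
      rw [integral_indicator_const _ measurableSet_Iic, ← hr, smul_eq_mul] at this
      rw [pow_succ, mul_comm]
      exact this
  have hle : |G c - G' c| ≤ 0 :=
    ge_of_tendsto' (tendsto_pow_atTop_nhds_zero_of_lt_one hr0 hr1) fun n => key n c hc
  exact sub_eq_zero.1 (abs_eq_zero.1 (le_antisymm hle (abs_nonneg _)))

open Set in
/-- The solution of the renewal equation. -/
theorem renewal_eq_exp {F : ℝ → ℝ} (hmono : Monotone F) (h0 : ∀ u, 0 ≤ F u)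
    (hrc : ∀ u, ContinuousWithinAt F (Ici u) u) {M : ℝ} (hM : ∀ u, M ≤ u → F u = 1) (c : ℝ) :
    Real.exp (c - ∫ v in (0 : ℝ)..c, F v) =
      ∫ s, F (c + s) * Real.exp (c + s - ∫ v in (0 : ℝ)..(c + s), F v) ∂expMeasure 1 := by
  rw [integral_expMeasure_one, sub_eq_add_neg, Real.exp_add,
    ← integral_Ioi_mul_exp_neg_primitive hmono h0 hrc hM c,
    ← integral_const_mul]
  -- Substitution u = c + s.
  rw [← (measurePreserving_add_left volume c).setIntegral_preimage_emb
    (measurableEmbedding_addLeft c), preimage_const_add_Ioi, sub_self]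
  refine setIntegral_congr_fun measurableSet_Ioi fun s _ => ?_
  simp only [sub_eq_add_neg, Real.exp_add]
  rw [Real.exp_neg s]
  have := (Real.exp_pos s).ne'
  field_simp

/-! ### Splitting off the first term of an i.i.d. sequence -/

/-- The sequence with a given first term and a given tail. -/
def consSeq {E : Type*} (y : E × (ℕ → E)) : ℕ → E
  | 0 => y.1
  | n + 1 => y.2 n

theorem measurable_consSeq {E : Type*} [MeasurableSpace E] :
    Measurable (consSeq : E × (ℕ → E) → ℕ → E) := by
  refine measurable_pi_lambda _ fun n => ?_
  cases n with
  | zero => exact measurable_fst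
  | succ n => exact (measurable_pi_apply n).comp measurable_snd

theorem measurePreserving_consSeq {E : Type*} [MeasurableSpace E] (μ : Measure E)
    [IsProbabilityMeasure μ] :
    MeasurePreserving consSeq (μ.prod (Measure.infinitePi fun _ : ℕ => μ))
      (Measure.infinitePi fun _ : ℕ => μ) := by
  classical
  refine ⟨measurable_consSeq, Measure.eq_infinitePi _ fun s t ht => ?_⟩
  -- Padding the constraints with `univ` up to index `N` turns the cylinder into one over an initial
  -- segment, where the first coordinate splits off cleanly.
  obtain ⟨N, hN⟩ := s.exists_nat_subset_range
  set t' : ℕ → Set E := fun i => if i ∈ s then t i else Set.univ with ht'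
  have hmt' : ∀ i, MeasurableSet (t' i) := fun i => by
    simp only [ht']; split_ifs
    exacts [ht i, .univ]
  have hpre : consSeq ⁻¹' (Set.pi s t) =
      t' 0 ×ˢ Set.pi (Finset.range N : Set ℕ) (fun i => t' (i + 1)) := by
    ext y
    simp only [Set.mem_preimage, Set.mem_pi, Set.mem_prod, ht', Finset.coe_range, Set.mem_Iio,
      SetLike.mem_coe]
    constructor
    · intro h
      refine ⟨?_, fun i _ => ?_⟩
      · split_ifs with h0
        exacts [h 0 h0, trivial]
      · split_ifs with h0
        exacts [h (i + 1) h0, trivial]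
    · rintro ⟨h0, h1⟩ i hi
      cases i with
      | zero => rwa [if_pos hi] at h0
      | succ i =>
        have := h1 i (by have := Finset.mem_range.1 (hN hi); omega)
        rwa [if_pos hi] at this
  have hprod : ∏ i ∈ s, μ (t i) = ∏ i ∈ Finset.range (N + 1), μ (t' i) := by
    rw [← Finset.prod_subset (hN.trans (Finset.range_mono N.le_succ))]
    · exact Finset.prod_congr rfl fun i hi => by simp [ht', hi]
    · intro i _ hi
      simp [ht', hi]
  rw [Measure.map_apply measurable_consSeq
      (MeasurableSet.pi s.countable_toSet fun i _ => ht i),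
    hpre, Measure.prod_prod, Measure.infinitePi_pi _ fun i _ => hmt' _, hprod,
    Finset.prod_range_succ', mul_comm]

/-- The joint law of an i.i.d. sequence of unit exponentials and an independent i.i.d. sequence of
law `ν`. -/
noncomputable def expSeqProd {E : Type*} [MeasurableSpace E] (ν : Measure E) :
    Measure ((ℕ → ℝ) × (ℕ → E)) :=
  (Measure.infinitePi fun _ : ℕ => expMeasure 1).prod (Measure.infinitePi fun _ : ℕ => ν)

instance {E : Type*} [MeasurableSpace E] (ν : Measure E) [IsProbabilityMeasure ν] :
    IsProbabilityMeasure (expSeqProd ν) := by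
  have := isProbabilityMeasure_expMeasure one_pos
  unfold expSeqProd
  infer_instance

/-! ### Avoidance probabilities of a Poisson process -/

/-- All points `(Γ_i, V (z_i))` lie on or below the line `v = c + γ`. -/
def belowSet {E : Type*} (V : E → ℝ) (c : ℝ) : Set ((ℕ → ℝ) × (ℕ → E)) :=
  {x | ∀ i, V (x.2 i) ≤ c + ∑ k ∈ Finset.range (i + 1), x.1 k}

theorem measurableSet_belowSet {E : Type*} [MeasurableSpace E] {V : E → ℝ}
    (hV : Measurable V) (c : ℝ) : MeasurableSet (belowSet V c) := by
  simp only [belowSet, Set.ofPred_forall]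
  refine MeasurableSet.iInter fun i => measurableSet_le ?_ ?_
  · exact hV.comp ((measurable_pi_apply i).comp measurable_snd)
  · fun_prop

/-- Joint measurability in the level is needed because, after the first arrival, the level c + E_1
is random. -/
theorem measurableSet_belowSet' {E : Type*} [MeasurableSpace E] {V : E → ℝ} (hV : Measurable V) :
    MeasurableSet {y : ℝ × ((ℕ → ℝ) × (ℕ → E)) | y.2 ∈ belowSet V y.1} := by
  have : {y : ℝ × ((ℕ → ℝ) × (ℕ → E)) | y.2 ∈ belowSet V y.1} =
      ⋂ i, {y | V (y.2.2 i) ≤ y.1 + ∑ k ∈ Finset.range (i + 1), y.2.1 k} := by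
    ext
    simp [belowSet]
  rw [this]
  refine MeasurableSet.iInter fun i => measurableSet_le ?_ ?_
  · exact hV.comp ((measurable_pi_apply i).comp (measurable_snd.comp measurable_snd))
  · fun_prop

theorem belowSet_mono {E : Type*} (V : E → ℝ) : Monotone (belowSet V) :=
  fun _ _ h _ hx i => (hx i).trans (by gcongr)

/-- All later sums contain the first arrival time, which can therefore be absorbed into the level:
the tail faces the same problem at height c + E_1. -/
theorem consSeq_mem_belowSet {E : Type*} (V : E → ℝ) (c : ℝ) (y : ℝ × (ℕ → ℝ)) (z : E × (ℕ → E)) :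
    (consSeq y, consSeq z) ∈ belowSet V c ↔
      V z.1 ≤ c + y.1 ∧ (y.2, z.2) ∈ belowSet V (c + y.1) := by
  have hsum : ∀ i, ∑ k ∈ Finset.range (i + 1 + 1), consSeq y k =
      y.1 + ∑ k ∈ Finset.range (i + 1), y.2 k := by
    intro i
    rw [Finset.sum_range_succ', add_comm]
    rfl
  constructor
  · intro h
    refine ⟨by simpa [consSeq] using h 0, fun i => ?_⟩
    have := h (i + 1)
    simp only [hsum] at this
    rw [add_assoc]
    exact this
  · rintro ⟨h0, h1⟩ i
    cases i with
    | zero => simpa [consSeq] using h0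
    | succ i =>
      have := h1 i
      rw [add_assoc] at this
      simp only [hsum]
      exact this

/-- The renewal equation: Fubini after splitting off the first pair, with the tail again distributed
as the whole sequence. -/
theorem expSeqProd_belowSet {E : Type*} [MeasurableSpace E] (ν : Measure E)
    [IsProbabilityMeasure ν] {V : E → ℝ} (hV : Measurable V) (c : ℝ) :
    expSeqProd ν (belowSet V c) =
      ∫⁻ s, ν {z | V z ≤ c + s} * expSeqProd ν (belowSet V (c + s)) ∂expMeasure 1 := by
  have := isProbabilityMeasure_expMeasure one_pos
  have hmp : MeasurePreserving (Prod.map consSeq consSeq)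
      (((expMeasure 1).prod (Measure.infinitePi fun _ : ℕ => expMeasure 1)).prod
        (ν.prod (Measure.infinitePi fun _ : ℕ => ν))) (expSeqProd ν) :=
    (measurePreserving_consSeq (expMeasure 1)).prod (measurePreserving_consSeq ν)
  have hS := measurableSet_belowSet hV c
  rw [← hmp.measure_preimage hS.nullMeasurableSet,
    Measure.prod_apply (hmp.measurable hS)]
  have hslice : ∀ y : ℝ × (ℕ → ℝ),
      (ν.prod (Measure.infinitePi fun _ : ℕ => ν))
        (Prod.mk y ⁻¹' (Prod.map consSeq consSeq ⁻¹' belowSet V c)) =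
      ν {z | V z ≤ c + y.1} *
        (Measure.infinitePi fun _ : ℕ => ν) (Prod.mk y.2 ⁻¹' belowSet V (c + y.1)) := by
    intro y
    rw [← Measure.prod_prod]
    congr 1
    ext z
    exact consSeq_mem_belowSet V c y z
  have hm1 : Measurable fun u : ℝ => ν {z | V z ≤ u} := by
    have : Monotone fun u : ℝ => ν {z | V z ≤ u} :=
      fun a b h => measure_mono fun z hz => le_trans hz h
    exact this.measurable
  have hm2 : Measurable fun y : ℝ × (ℕ → ℝ) =>
      (Measure.infinitePi fun _ : ℕ => ν) (Prod.mk y.2 ⁻¹' belowSet V (c + y.1)) := by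
    have h1 : MeasurableSet
        {w : (ℝ × (ℕ → ℝ)) × (ℕ → E) | (w.1.2, w.2) ∈ belowSet V (c + w.1.1)} :=
      (measurableSet_belowSet' hV).preimage
        (f := fun w : (ℝ × (ℕ → ℝ)) × (ℕ → E) => (c + w.1.1, (w.1.2, w.2))) (by fun_prop)
    exact measurable_measure_prodMk_left h1
  simp_rw [hslice]
  have hm3 : Measurable fun y : ℝ × (ℕ → ℝ) => ν {z | V z ≤ c + y.1} :=
    hm1.comp (measurable_fst.const_add c)
  rw [lintegral_prod _ (hm3.fun_mul hm2).aemeasurable]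
  refine lintegral_congr fun s => ?_
  dsimp only
  have hm4 : Measurable fun y : ℕ → ℝ =>
      (Measure.infinitePi fun _ : ℕ => ν) (Prod.mk y ⁻¹' belowSet V (c + s)) :=
    measurable_measure_prodMk_left (measurableSet_belowSet hV _)
  rw [lintegral_const_mul _ hm4, expSeqProd, Measure.prod_apply (measurableSet_belowSet hV _)]

theorem ae_expSeqProd_pos {E : Type*} [MeasurableSpace E] (ν : Measure E) [IsProbabilityMeasure ν] :
    ∀ᵐ x ∂expSeqProd ν, ∀ k, 0 < x.1 k := by
  have := isProbabilityMeasure_expMeasure one_pos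
  rw [ae_all_iff]
  intro k
  have h1 : ∀ᵐ e ∂(Measure.infinitePi fun _ : ℕ => expMeasure 1), 0 < e k :=
    (measurePreserving_eval_infinitePi (fun _ : ℕ => expMeasure 1) k).quasiMeasurePreserving.ae
      ae_expMeasure_one_pos
  exact Measure.quasiMeasurePreserving_fst.ae h1

/-- Boundary condition for the renewal equation: partial sums are almost surely nonnegative. -/
theorem expSeqProd_belowSet_of_le {E : Type*} [MeasurableSpace E] (ν : Measure E)
    [IsProbabilityMeasure ν] {V : E → ℝ} {M : ℝ} (hVM : ∀ z, V z ≤ M) {c : ℝ} (hc : M ≤ c) :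
    expSeqProd ν (belowSet V c) = 1 := by
  have h : belowSet V c =ᵐ[expSeqProd ν] Set.univ := by
    refine Filter.eventuallyEq_univ.2 ?_
    filter_upwards [ae_expSeqProd_pos ν] with x hx i
    have : 0 ≤ ∑ k ∈ Finset.range (i + 1), x.1 k := Finset.sum_nonneg fun k _ => (hx k).le
    linarith [hVM (x.2 i)]
  rw [measure_congr h, measure_univ]

open Set in
/-- The avoidance probability of a Poisson process, for a bounded region. -/
theorem expSeqProd_belowSet_zero_of_bounded {E : Type*} [MeasurableSpace E] (ν : Measure E)
    [IsProbabilityMeasure ν] {V : E → ℝ}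
    (hV : Measurable V) (hV0 : ∀ z, 0 ≤ V z) {M : ℝ} (hVM : ∀ z, V z ≤ M) :
    expSeqProd ν (belowSet V 0) = ENNReal.ofReal (Real.exp (-∫ z, V z ∂ν)) := by
  have hne : Nonempty E := nonempty_of_isProbabilityMeasure ν
  have hM0 : 0 ≤ M := (hV0 hne.some).trans (hVM _)
  have hprob : IsProbabilityMeasure (ν.map V) := Measure.isProbabilityMeasure_map hV.aemeasurable
  set F : ℝ → ℝ := fun u => cdf (ν.map V) u with hF
  have hFeq : ∀ u, F u = ν.real {z | V z ≤ u} := by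
    intro u
    simp only [hF]
    rw [cdf_eq_real, map_measureReal_apply hV measurableSet_Iic]
    rfl
  have hmono : Monotone F := monotone_cdf _
  have hrc : ∀ u, ContinuousWithinAt F (Ici u) u := fun u => (cdf (ν.map V)).right_continuous u
  have hF0 : ∀ u, 0 ≤ F u := cdf_nonneg _
  have hF1 : ∀ u, F u ≤ 1 := cdf_le_one _
  have hFM : ∀ u, M ≤ u → F u = 1 := by
    intro u hu
    have : {z | V z ≤ u} = univ := eq_univ_of_forall fun z => (hVM z).trans hu
    rw [hFeq, this, probReal_univ]
  have hint : ∀ a b, IntervalIntegrable F volume a b := fun a b => hmono.intervalIntegrable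
  -- `B` is the primitive of 1 - F, so it increases up to `M` and is constant afterwards; `B M` is
  -- E[V] by the layer-cake formula.
  set B : ℝ → ℝ := fun c => c - ∫ v in (0 : ℝ)..c, F v with hB
  have hBsub : ∀ a b, B b - B a = ∫ v in a..b, (1 - F v) := by
    intro a b
    rw [intervalIntegral.integral_sub (by simp) (hint a b),
      ← intervalIntegral.integral_add_adjacent_intervals (hint a 0) (hint 0 b),
      intervalIntegral.integral_symm 0 a]
    simp [hB]
    ring
  have hBle : ∀ c, B c ≤ B M := by
    intro c
    rcases le_total c M with h | h
    · rw [← sub_nonneg, hBsub]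
      exact intervalIntegral.integral_nonneg h fun u _ => sub_nonneg.2 (hF1 u)
    · rw [← sub_nonneg, hBsub, intervalIntegral.integral_symm,
        intervalIntegral.integral_congr (g := fun _ => (0 : ℝ))]
      · simp
      · intro u hu
        rw [uIcc_of_le h] at hu
        simp [hFM u hu.1]
  have hBM : ∀ c, M ≤ c → B c = B M := by
    intro c h
    rw [← sub_eq_zero, hBsub, intervalIntegral.integral_congr (g := fun _ => (0 : ℝ))]
    · simp
    · intro u hu
      rw [uIcc_of_le h] at hu
      simp [hFM u hu.1]
  have hBM' : ∫ z, V z ∂ν = B M := by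
    have hB0 : B 0 = 0 := by simp [hB]
    have hVi : Integrable V ν := Integrable.of_bound (C := M) hV.aestronglyMeasurable
      (.of_forall fun z => by rw [Real.norm_eq_abs, abs_of_nonneg (hV0 z)]; exact hVM z)
    rw [hVi.integral_eq_integral_meas_lt (.of_forall hV0), ← sub_zero (B M), ← hB0, hBsub,
      intervalIntegral.integral_of_le hM0]
    have h1 : ∀ t, ν.real {a | t < V a} = 1 - F t := by
      intro t
      have hc : {a | t < V a} = {a | V a ≤ t}ᶜ := by ext; simp
      rw [hc, measureReal_compl (s := {a | V a ≤ t}) (hV measurableSet_Iic), probReal_univ, hFeq]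
    simp_rw [h1]
    rw [hB0]
    refine setIntegral_eq_of_subset_of_forall_sdiff_eq_zero measurableSet_Ioi
      Ioc_subset_Ioi_self fun t ht => ?_
    have : M < t := by
      by_contra h
      exact ht.2 ⟨ht.1, not_lt.1 h⟩
    rw [hFM t this.le, sub_self]
  set G : ℝ → ℝ := fun c => (expSeqProd ν).real (belowSet V c) with hG
  have hGmono : Monotone G := fun a b h => measureReal_mono (belowSet_mono V h)
  have hBmeas : Measurable B :=
    measurable_id.sub (intervalIntegral.continuous_primitive hint 0).measurable
  have hGM : ∀ c, M ≤ c → G c = 1 := fun c hc => by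
    simp [hG, Measure.real, expSeqProd_belowSet_of_le ν hVM hc]
  -- The solution exp ∘ B of the renewal equation is divided by exp (B M), so that it equals 1 from
  -- `M` on, as `G` does.
  have key : G 0 = Real.exp (B 0 - B M) := by
    refine renewal_unique (G := G) (G' := fun c => Real.exp (B c - B M)) (M := M)
      hmono.measurable hGmono.measurable (by fun_prop) hF0 hF1 (fun _ => measureReal_nonneg)
      (fun _ => measureReal_le_one) (fun _ _ => (Real.exp_pos _).le)
      (fun c _ => Real.exp_le_one_iff.2 (sub_nonpos.2 (hBle c)))
      (fun c hc => by simp [hGM c hc, hBM c hc]) ?_ ?_ le_rfl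
    · intro c _
      simp only [hG, Measure.real]
      rw [expSeqProd_belowSet ν hV c, ← integral_toReal]
      · refine integral_congr_ae (.of_forall fun s => ?_)
        simp [hFeq, Measure.real]
      · have h1 : Measurable fun u : ℝ => ν {z | V z ≤ u} := by
          have : Monotone fun u : ℝ => ν {z | V z ≤ u} :=
            fun a b h => measure_mono fun z hz => le_trans hz h
          exact this.measurable
        have h2 : Measurable fun u : ℝ => expSeqProd ν (belowSet V u) := by
          have : Monotone fun u : ℝ => expSeqProd ν (belowSet V u) :=
            fun a b h => measure_mono (belowSet_mono V h)
          exact this.measurable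
        exact ((h1.comp (measurable_const_add c)).mul
          (h2.comp (measurable_const_add c))).aemeasurable
      · exact .of_forall fun s => ENNReal.mul_lt_top (measure_lt_top _ _) (measure_lt_top _ _)
    · intro c _
      simp only [Real.exp_sub _ (B M), div_eq_mul_inv, ← mul_assoc]
      rw [integral_mul_const]
      congr 1
      exact renewal_eq_exp hmono hF0 hrc hFM c
  have hB0 : B 0 = 0 := by simp [hB]
  rw [hB0, zero_sub] at key
  rw [hBM', ← key, hG, ofReal_measureReal]

open Filter Topology in
/-- The avoidance probability of a Poisson process: none of the points `(Γ_i, z_i)` satisfies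
`Γ_i < V (z_i)` with probability `exp (-E[V])`. -/
theorem expSeqProd_forall_le {E : Type*} [MeasurableSpace E] (ν : Measure E)
    [IsProbabilityMeasure ν] {V : E → ℝ≥0∞} (hV : Measurable V) :
    expSeqProd ν {x | ∀ i, V (x.2 i) ≤ ENNReal.ofReal (∑ k ∈ Finset.range (i + 1), x.1 k)} =
      EReal.exp (-((∫⁻ z, V z ∂ν : ℝ≥0∞) : EReal)) := by
  -- Truncation reduces to bounded regions. The events decrease to the desired one and the integrals
  -- increase to that of `V`, possibly to ∞, where the exponential is 0.
  set Vn : ℕ → E → ℝ≥0∞ := fun n z => min (V z) n with hVn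
  have hVn_meas : ∀ n, Measurable (Vn n) := fun n => hV.min measurable_const
  have hVn_top : ∀ n z, Vn n z ≠ ∞ := fun n z =>
    ne_top_of_le_ne_top (ENNReal.natCast_ne_top n) (min_le_right _ _)
  have hVn_mono : Monotone Vn := fun m n h z => min_le_min le_rfl (by exact_mod_cast h)
  have hVn_lim : ∀ z, Tendsto (fun n => Vn n z) atTop (𝓝 (V z)) := by
    intro z
    have h := (tendsto_const_nhds (x := V z)).min ENNReal.tendsto_nat_nhds_top
    simpa using h
  have hval : ∀ n, expSeqProd ν (belowSet (fun z => (Vn n z).toReal) 0) =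
      EReal.exp (-((∫⁻ z, Vn n z ∂ν : ℝ≥0∞) : EReal)) := by
    intro n
    have hfin : ∫⁻ z, Vn n z ∂ν ≠ ∞ := by
      refine ne_top_of_le_ne_top (ENNReal.natCast_ne_top n) ?_
      calc ∫⁻ z, Vn n z ∂ν ≤ ∫⁻ _, (n : ℝ≥0∞) ∂ν := lintegral_mono fun z => min_le_right _ _
        _ = n := by simp
    rw [expSeqProd_belowSet_zero_of_bounded ν (hVn_meas n).ennreal_toReal
      (fun _ => ENNReal.toReal_nonneg) (M := n)
      (fun z => ENNReal.toReal_le_of_le_ofReal n.cast_nonneg (by simp [hVn])),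
      integral_toReal (hVn_meas n).aemeasurable (.of_forall fun z => (hVn_top n z).lt_top),
      ← EReal.exp_coe, EReal.coe_neg, EReal.coe_ennreal_toReal hfin]
  -- Equality holds only almost surely, since `ENNReal.ofReal` would clip negative partial sums to
  -- 0.
  have hset : {x : (ℕ → ℝ) × (ℕ → E) |
        ∀ i, V (x.2 i) ≤ ENNReal.ofReal (∑ k ∈ Finset.range (i + 1), x.1 k)} =ᵐ[expSeqProd ν]
      ⋂ n, belowSet (fun z => (Vn n z).toReal) 0 := by
    rw [Filter.eventuallyEq_set]
    filter_upwards [ae_expSeqProd_pos ν] with x hx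
    have h0 : ∀ i, 0 ≤ ∑ k ∈ Finset.range (i + 1), x.1 k :=
      fun i => Finset.sum_nonneg fun k _ => (hx k).le
    simp only [Set.mem_ofPred_eq, Set.mem_iInter, belowSet, zero_add]
    constructor
    · exact fun h n i => ENNReal.toReal_le_of_le_ofReal (h0 i) ((min_le_left _ _).trans (h i))
    · exact fun h i => le_of_tendsto' (hVn_lim (x.2 i)) fun n =>
        (ENNReal.le_ofReal_iff_toReal_le (hVn_top n _) (h0 i)).2 (h n i)
  rw [measure_congr hset]
  have hanti : Antitone fun n => belowSet (fun z => (Vn n z).toReal) 0 :=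
    fun m n h x hx i => (ENNReal.toReal_mono (hVn_top _ _) (hVn_mono h _)).trans (hx i)
  have h1 := tendsto_measure_iInter_atTop (μ := expSeqProd ν)
    (fun n => (measurableSet_belowSet (hVn_meas n).ennreal_toReal 0).nullMeasurableSet)
    hanti ⟨0, measure_ne_top _ _⟩
  refine tendsto_nhds_unique h1 ?_
  simp only [Function.comp_def, hval]
  refine (ENNReal.continuous_exp.tendsto _).comp ((continuous_neg.tendsto _).comp
    ((continuous_coe_ennreal_ereal.tendsto _).comp ?_))
  exact lintegral_tendsto_of_tendsto_of_monotone (fun n => (hVn_meas n).aemeasurable)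
    (.of_forall fun z m n h => hVn_mono h z) (.of_forall hVn_lim)

/-! ### Finite-dimensional distribution functions -/

/-- Positive levels which are a constraint at finitely many points only. -/
def IsFiniteLevel {T : Type*} {d : ℕ} (x : T → Fin d → ℝ≥0∞) : Prop :=
  {t | x t ≠ ⊤}.Finite ∧ ∀ t j, 0 < x t j

namespace IsFiniteLevel

variable {T : Type*} {d : ℕ}

theorem top : IsFiniteLevel (⊤ : T → Fin d → ℝ≥0∞) := by
  constructor
  · simp
  · simp

theorem inf {x y : T → Fin d → ℝ≥0∞} (hx : IsFiniteLevel x) (hy : IsFiniteLevel y) :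
    IsFiniteLevel (x ⊓ y) := by
  refine ⟨(hx.1.union hy.1).subset fun t ht => ?_, fun t j => lt_min (hx.2 t j) (hy.2 t j)⟩
  by_contra h
  simp only [Set.mem_union, Set.mem_ofPred_eq, not_or, not_not] at h
  exact ht (by simp [h.1, h.2])

theorem update [DecidableEq T] (t : T) (j : Fin d) {a : ℝ≥0∞} (ha : 0 < a) :
    IsFiniteLevel (Function.update (⊤ : T → Fin d → ℝ≥0∞) t (Function.update ⊤ j a)) := by
  refine ⟨(Set.finite_singleton t).subset fun s hs => ?_, fun s k => ?_⟩
  · by_contra h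
    exact hs (by rw [Function.update_of_ne h]; rfl)
  · by_cases h : s = t
    · subst h
      by_cases hk : k = j
      · subst hk; simpa using ha
      · simp [hk]
    · simp [h]

theorem measurableSet_Iic {x : T → Fin d → ℝ≥0∞} (hx : IsFiniteLevel x) :
    MeasurableSet (Set.Iic x) := by
  have : Set.Iic x = ⋂ t ∈ {t | x t ≠ ⊤}, ⋂ j, {y : T → Fin d → ℝ≥0∞ | y t j ≤ x t j} := by
    ext y
    simp only [Set.mem_Iic, Set.mem_iInter, Set.mem_ofPred_eq]
    refine ⟨fun h t _ j => h t j, fun h t j => ?_⟩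
    by_cases ht : x t = ⊤
    · simp [ht]
    · exact h t ht j
  rw [this]
  refine hx.1.measurableSet_biInter fun t _ => MeasurableSet.iInter fun j => ?_
  exact measurableSet_le ((measurable_pi_apply j).comp (measurable_pi_apply t)) measurable_const

end IsFiniteLevel

theorem generateFrom_Iic_isFiniteLevel {T : Type*} {d : ℕ} :
    (inferInstance : MeasurableSpace (T → Fin d → ℝ≥0∞)) =
      MeasurableSpace.generateFrom {S | ∃ x, IsFiniteLevel x ∧ S = Set.Iic x} := by
  classical
  refine le_antisymm ?_ (MeasurableSpace.generateFrom_le ?_)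
  · refine iSup_le fun t => ?_
    rw [MeasurableSpace.comap_le_iff_le_map]
    refine iSup_le fun j => ?_
    rw [MeasurableSpace.comap_le_iff_le_map]
    change Measurable[MeasurableSpace.generateFrom {S | ∃ x, IsFiniteLevel x ∧ S = Set.Iic x}]
      (fun y : T → Fin d → ℝ≥0∞ => y t j)
    let _ : MeasurableSpace (T → Fin d → ℝ≥0∞) :=
      MeasurableSpace.generateFrom {S | ∃ x, IsFiniteLevel x ∧ S = Set.Iic x}
    refine measurable_of_Iic fun a => ?_
    -- Levels must be strictly positive, so a bound by `a`, possibly 0, is approached from above by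
    -- a + 1/n.
    have hset : (fun y : T → Fin d → ℝ≥0∞ => y t j) ⁻¹' Set.Iic a = ⋂ n : ℕ,
        Set.Iic (Function.update (⊤ : T → Fin d → ℝ≥0∞) t
          (Function.update ⊤ j (a + (n : ℝ≥0∞)⁻¹))) := by
      ext y
      simp only [Set.mem_preimage, Set.mem_Iic, Set.mem_iInter]
      constructor
      · intro h n s k
        by_cases hs : s = t
        · subst hs
          by_cases hk : k = j
          · subst hk
            simpa using h.trans le_self_add
          · simp [hk]
        · simp [hs]
      · intro h
        have h1 : Filter.Tendsto (fun n : ℕ => a + (n : ℝ≥0∞)⁻¹) Filter.atTop (nhds (a + 0)) :=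
          ENNReal.tendsto_inv_nat_nhds_zero.const_add a
        rw [add_zero] at h1
        refine ge_of_tendsto' h1 fun n => ?_
        simpa using h n t j
    rw [hset]
    refine MeasurableSet.iInter fun n =>
      MeasurableSpace.measurableSet_generateFrom ⟨_, IsFiniteLevel.update t j ?_, rfl⟩
    simp
  · rintro _ ⟨x, hx, rfl⟩
    exact hx.measurableSet_Iic

/-- A finite measure on a product space is determined by its distribution function at finite
levels. -/
theorem ext_of_Iic_isFiniteLevel {T : Type*} {d : ℕ} {μ μ' : Measure (T → Fin d → ℝ≥0∞)}
    [IsFiniteMeasure μ] (h : ∀ x, IsFiniteLevel x → μ (Set.Iic x) = μ' (Set.Iic x)) :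
    μ = μ' := by
  refine ext_of_generate_finite _ generateFrom_Iic_isFiniteLevel ?_ ?_ ?_
  · rintro _ ⟨x, hx, rfl⟩ _ ⟨y, hy, rfl⟩ _
    exact ⟨_, hx.inf hy, Set.Iic_inter_Iic⟩
  · rintro _ ⟨x, hx, rfl⟩
    exact h x hx
  · have := h ⊤ IsFiniteLevel.top
    rwa [Set.Iic_top] at this

/-- A path as a point of the product space of all `[0, ∞]^d`-valued functions. -/
noncomputable def pathEmb {p d : ℕ} (f : PathSpace p d) : (Fin p → ℝ) → Fin d → ℝ≥0∞ :=
  fun t j => (f t j : ℝ≥0∞)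

theorem PathSpace.measurable_coord {p d : ℕ} (t : Fin p → ℝ) (j : Fin d) :
    Measurable fun f : PathSpace p d => (f t j : ℝ≥0∞) :=
  measurable_coe_nnreal_ennreal.comp ((measurable_pi_apply j).comp (PathSpace.measurable_eval t))

theorem measurable_pathEmb {p d : ℕ} : Measurable (pathEmb : PathSpace p d → _) :=
  measurable_pi_lambda _ fun t => measurable_pi_lambda _ fun j => PathSpace.measurable_coord t j

/-- Each evaluation is recovered measurably from the embedding by `toNNReal`, so no information is
lost by passing to the product space, although the image need not be measurable there. -/
theorem comap_pathEmb {p d : ℕ} :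
    MeasurableSpace.comap pathEmb inferInstance = PathSpace.instMeasurableSpace p d := by
  refine le_antisymm measurable_pathEmb.comap_le (iSup_le fun t => ?_)
  have h : Measurable fun (y : (Fin p → ℝ) → Fin d → ℝ≥0∞) j => (y t j).toNNReal :=
    measurable_pi_lambda _ fun j =>
      ENNReal.measurable_toNNReal.comp ((measurable_pi_apply j).comp (measurable_pi_apply t))
  have h2 : (fun f : PathSpace p d => f t) =
      (fun (y : (Fin p → ℝ) → Fin d → ℝ≥0∞) j => (y t j).toNNReal) ∘ pathEmb := by
    ext
    simp [pathEmb]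
  rw [h2, ← MeasurableSpace.comap_comp]
  exact MeasurableSpace.comap_mono h.comap_le

theorem PathSpace.measure_ext_of_map_pathEmb {p d : ℕ} {μ μ' : Measure (PathSpace p d)}
    (h : μ.map pathEmb = μ'.map pathEmb) : μ = μ' := by
  ext A hA
  rw [← comap_pathEmb] at hA
  obtain ⟨B, hB, rfl⟩ := hA
  rw [← Measure.map_apply measurable_pathEmb hB, h, Measure.map_apply measurable_pathEmb hB]

/-! ### Exponents and the law of the max-stable process -/

/-- The exponent `max_{t, j} (f_j(t) / x_j(t)) ^ α`. -/
noncomputable def scaledSup {p d : ℕ} (α : ℝ) (x : (Fin p → ℝ) → Fin d → ℝ≥0∞)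
    (f : PathSpace p d) : ℝ≥0∞ :=
  ⨆ t, ⨆ j, (f t j : ℝ≥0∞) ^ α / x t j ^ α

section ScaledSup

variable {p d : ℕ} {α : ℝ}

/-- Division by ∞^α = ∞ gives 0, so points where the level is `⊤` do not contribute; for finite
levels only a finite supremum remains. -/
theorem scaledSup_eq_biSup (hα : 0 < α) (x : (Fin p → ℝ) → Fin d → ℝ≥0∞) (f : PathSpace p d) :
    scaledSup α x f = ⨆ t ∈ {t | x t ≠ ⊤}, ⨆ j, (f t j : ℝ≥0∞) ^ α / x t j ^ α := by
  refine iSup_congr fun t => ?_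
  by_cases ht : x t = ⊤
  · simp [ht, hα]
  · simp [ht]

theorem measurable_scaledSup (hα : 0 < α) {x : (Fin p → ℝ) → Fin d → ℝ≥0∞}
    (hx : IsFiniteLevel x) : Measurable (scaledSup α x) := by
  have : scaledSup α x = fun f : PathSpace p d =>
      ⨆ t ∈ {t | x t ≠ ⊤}, ⨆ j, (f t j : ℝ≥0∞) ^ α / x t j ^ α :=
    funext fun f => scaledSup_eq_biSup hα x f
  rw [this]
  exact Measurable.biSup _ hx.1.countable fun t _ => Measurable.iSup fun j =>
    ((PathSpace.measurable_coord t j).pow_const α).div_const _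

theorem scaledSup_eq_zero (hα : 0 < α) {x : (Fin p → ℝ) → Fin d → ℝ≥0∞} {f : PathSpace p d}
    (h : ∀ t, x t ≠ ⊤ → f t = 0) : scaledSup α x f = 0 := by
  rw [scaledSup_eq_biSup hα]
  simp only [ENNReal.iSup_eq_zero]
  intro t ht j
  simp [h t ht, hα]

theorem isHomogeneousFunctional_scaledSup (hα : 0 < α) {x : (Fin p → ℝ) → Fin d → ℝ≥0∞}
    (hx : IsFiniteLevel x) : IsHomogeneousFunctional α (scaledSup α x) := by
  refine ⟨measurable_scaledSup hα hx, fun c _ f => ?_⟩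
  simp only [scaledSup, ENNReal.mul_iSup]
  refine iSup_congr fun t => iSup_congr fun j => ?_
  simp [ENNReal.mul_rpow_of_nonneg _ _ hα.le, mul_div_assoc]

/-- Dividing by a level is antitone, so minima of levels become maxima of exponents. This closure
property is what allows the exponent to be perturbed in a single coordinate. -/
theorem scaledSup_inf (hα : 0 < α) (x y : (Fin p → ℝ) → Fin d → ℝ≥0∞) (f : PathSpace p d) :
    scaledSup α (x ⊓ y) f = scaledSup α x f ⊔ scaledSup α y f := by
  simp only [scaledSup, ← iSup_sup_eq]
  refine iSup_congr fun t => iSup_congr fun j => ?_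
  have hanti : Antitone fun a : ℝ≥0∞ => (f t j : ℝ≥0∞) ^ α / a ^ α :=
    fun a b h => ENNReal.div_le_div_left (ENNReal.rpow_le_rpow h hα.le) _
  exact hanti.map_min

theorem scaledSup_update [DecidableEq (Fin p → ℝ)] (hα : 0 < α) (t : Fin p → ℝ) (j : Fin d)
    (a : ℝ≥0∞) (f : PathSpace p d) :
    scaledSup α (Function.update ⊤ t (Function.update ⊤ j a)) f = (f t j : ℝ≥0∞) ^ α / a ^ α := by
  refine le_antisymm (iSup_le fun s => iSup_le fun k => ?_) ?_
  · by_cases hs : s = t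
    · subst hs
      by_cases hk : k = j
      · subst hk; simp
      · simp [hk, hα]
    · simp [hs, hα]
  · refine le_iSup_of_le t (le_iSup_of_le j ?_)
    simp

/-- Raising to the power α turns a bound on Γ_i^(-1/α) Z^(i) into a lower bound on the arrival time
Γ_i. -/
theorem ofReal_rpow_mul_le_iff (hα : 0 < α) {g : ℝ} (hg : 0 < g) (a x : ℝ≥0∞) :
    ENNReal.ofReal (g ^ (-1 / α)) * a ≤ x ↔ a ^ α / x ^ α ≤ ENNReal.ofReal g := by
  have hg0 : ENNReal.ofReal g ≠ 0 := by simpa using hg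
  rw [ENNReal.div_le_iff_le_mul (.inr ENNReal.ofReal_ne_top) (.inr hg0),
    ← ENNReal.rpow_le_rpow_iff hα, ENNReal.mul_rpow_of_nonneg _ _ hα.le,
    ← ENNReal.ofReal_rpow_of_pos hg, ← ENNReal.rpow_mul, div_mul_cancel₀ _ hα.ne',
    ENNReal.rpow_neg_one, ENNReal.inv_mul_le_iff hg0 ENNReal.ofReal_ne_top]

theorem scaledSup_le_one_iff (hα : 0 < α) (x : (Fin p → ℝ) → Fin d → ℝ≥0∞) (f : PathSpace p d) :
    scaledSup α x f ≤ 1 ↔ pathEmb f ≤ x := by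
  simp only [scaledSup, iSup_le_iff, Pi.le_def]
  refine forall_congr' fun t => forall_congr' fun j => ?_
  have := ofReal_rpow_mul_le_iff hα one_pos (f t j) (x t j)
  simp only [Real.one_rpow, ENNReal.ofReal_one, one_mul] at this
  exact this.symm

/-- The finite-dimensional distribution functions of the max-stable process. -/
theorem deHaanLaw_Iic (hα : 0 < α) (ν : Measure (PathSpace p d)) [IsProbabilityMeasure ν]
    {x : (Fin p → ℝ) → Fin d → ℝ≥0∞} (hx : IsFiniteLevel x) :
    deHaanLaw α ν (Set.Iic x) =
      EReal.exp (-((∫⁻ f, scaledSup α x f ∂ν : ℝ≥0∞) : EReal)) := by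
  rw [← expSeqProd_forall_le ν (measurable_scaledSup hα hx), deHaanLaw,
    Measure.map_apply (measurable_deHaanMax α) hx.measurableSet_Iic]
  refine measure_congr (Filter.eventuallyEq_set.2 ?_)
  filter_upwards [ae_expSeqProd_pos ν] with e he
  simp only [Set.mem_preimage, Set.mem_Iic, Pi.le_def, deHaanMax, iSup_le_iff,
    scaledSup]
  have hpos : ∀ i, 0 < ∑ k ∈ Finset.range (i + 1), e.1 k :=
    fun i => Finset.sum_pos (fun k _ => he k) Finset.nonempty_range_add_one
  simp only [ofReal_rpow_mul_le_iff hα (hpos _)]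
  exact ⟨fun h i t j => h t j i, fun h t j i => h i t j⟩

instance (ν : Measure (PathSpace p d)) [IsProbabilityMeasure ν] :
    IsProbabilityMeasure (deHaanLaw α ν) := by
  have := isProbabilityMeasure_expMeasure one_pos
  exact Measure.isProbabilityMeasure_map (measurable_deHaanMax α).aemeasurable

/-- The law of the max-stable process is determined by, and determines, the integrals of the
exponents. -/
theorem deHaanLaw_eq_iff (hα : 0 < α) (ν ν' : Measure (PathSpace p d)) [IsProbabilityMeasure ν]
    [IsProbabilityMeasure ν'] :
    deHaanLaw α ν = deHaanLaw α ν' ↔ ∀ x, IsFiniteLevel x →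
      ∫⁻ f, scaledSup α x f ∂ν = ∫⁻ f, scaledSup α x f ∂ν' := by
  constructor
  · intro h x hx
    have h1 := congrArg (fun m => m (Set.Iic x)) h
    simp only [deHaanLaw_Iic hα _ hx] at h1
    exact EReal.coe_ennreal_injective (neg_injective (EReal.exp_strictMono.injective h1))
  · intro h
    refine ext_of_Iic_isFiniteLevel fun x hx => ?_
    rw [deHaanLaw_Iic hα _ hx, deHaanLaw_Iic hα _ hx, h x hx]

end ScaledSup

/-! ### Localising homogeneous functionals to cones -/

section Homogeneous

variable {p d : ℕ} {α : ℝ}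

theorem IsHomogeneousFunctional.indicator {H : PathSpace p d → ℝ≥0∞}
    (hH : IsHomogeneousFunctional α H) {A : Set (PathSpace p d)} (hA : MeasurableSet A)
    (hcone : ∀ c : ℝ≥0, 0 < c → ∀ f, c • f ∈ A ↔ f ∈ A) :
    IsHomogeneousFunctional α (A.indicator H) := by
  refine ⟨hH.measurable.indicator hA, fun c hc f => ?_⟩
  by_cases hf : f ∈ A
  · rw [Set.indicator_of_mem hf, Set.indicator_of_mem ((hcone c hc f).2 hf), hH.map_smul c hc]
  · rw [Set.indicator_of_notMem hf, Set.indicator_of_notMem (mt (hcone c hc f).1 hf), mul_zero]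

/-- Equality of the integrals of homogeneous functionals may be checked on countably many cones
which cover the support. -/
theorem lintegral_eq_of_forall_cone {ι : Type*} [Countable ι] {ν ν' : Measure (PathSpace p d)}
    {A : ι → Set (PathSpace p d)} (hA : ∀ i, MeasurableSet (A i))
    (hcone : ∀ i, ∀ c : ℝ≥0, 0 < c → ∀ f, c • f ∈ A i ↔ f ∈ A i)
    (h : ∀ i H, IsHomogeneousFunctional α H → ∫⁻ f in A i, H f ∂ν = ∫⁻ f in A i, H f ∂ν')
    {H : PathSpace p d → ℝ≥0∞} (hH : IsHomogeneousFunctional α H)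
    (h0 : ∀ᵐ f ∂ν, (∃ i, f ∈ A i) ∨ H f = 0) (h0' : ∀ᵐ f ∂ν', (∃ i, f ∈ A i) ∨ H f = 0) :
    ∫⁻ f, H f ∂ν = ∫⁻ f, H f ∂ν' := by
  -- The empty index set does occur: for the level `⊤`, and for d = 0.
  rcases isEmpty_or_nonempty ι with hι | hι
  · have : ∀ m : Measure (PathSpace p d), (∀ᵐ f ∂m, (∃ i, f ∈ A i) ∨ H f = 0) →
        ∫⁻ f, H f ∂m = 0 := fun m hm => by
      rw [lintegral_eq_zero_iff hH.measurable]
      filter_upwards [hm] with f hf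
      simpa using hf
    rw [this ν h0, this ν' h0']
  obtain ⟨e, he⟩ := exists_surjective_nat ι
  set B : ℕ → Set (PathSpace p d) := disjointed (A ∘ e) with hB
  have hBA : ∀ n, B n ⊆ A (e n) := fun n => disjointed_subset (A ∘ e) n
  have hBm : ∀ n, MeasurableSet (B n) := MeasurableSet.disjointed fun n => hA (e n)
  -- Differences of cones are cones, so disjointification keeps the restricted functionals
  -- homogeneous.
  have hBcone : ∀ n, ∀ c : ℝ≥0, 0 < c → ∀ f, c • f ∈ B n ↔ f ∈ B n := by
    intro n
    refine disjointedRec (f := A ∘ e)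
      (p := fun S : Set (PathSpace p d) => ∀ c : ℝ≥0, 0 < c → ∀ f, c • f ∈ S ↔ f ∈ S)
      (fun S i hS c hc f => ?_) (hcone (e n))
    simp only [Set.mem_sdiff, Function.comp_apply]
    rw [hS c hc f, hcone (e i) c hc f]
  have hU : ⋃ n, B n = ⋃ i, A i := by
    rw [hB, iUnion_disjointed]
    exact he.iUnion_comp A
  have key : ∀ m : Measure (PathSpace p d), (∀ᵐ f ∂m, (∃ i, f ∈ A i) ∨ H f = 0) →
      ∫⁻ f, H f ∂m = ∑' n, ∫⁻ f in A (e n), (B n).indicator H f ∂m := by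
    intro m hm
    have h1 : ∫⁻ f, H f ∂m = ∫⁻ f in ⋃ n, B n, H f ∂m := by
      rw [← lintegral_indicator (MeasurableSet.iUnion hBm), hU]
      refine lintegral_congr_ae ?_
      filter_upwards [hm] with f hf
      by_cases hf' : f ∈ ⋃ i, A i
      · rw [Set.indicator_of_mem hf']
      · rw [Set.indicator_of_notMem hf']
        exact hf.resolve_left fun h => hf' (Set.mem_iUnion.2 h)
    rw [h1, lintegral_iUnion hBm (disjoint_disjointed _)]
    refine tsum_congr fun n => ?_
    rw [setLIntegral_indicator (hBm n), Set.inter_eq_left.2 (hBA n)]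
  rw [key ν h0, key ν' h0']
  exact tsum_congr fun n => h _ _ (hH.indicator (hBm n) (hBcone n))

end Homogeneous

/-! ### Tilting by a power and rescaling -/

section Tilting

variable {p d : ℕ} {α : ℝ}

theorem PathSpace.measurable_smul {g : PathSpace p d → ℝ≥0} (hg : Measurable g) :
    Measurable fun f : PathSpace p d => g f • f := by
  refine PathSpace.measurable_of_eval fun t => measurable_pi_lambda _ fun j => ?_
  exact hg.mul ((measurable_pi_apply j).comp (PathSpace.measurable_eval t))

/-- The law of `f / g(f)` under the measure with density `g ^ α`. -/
noncomputable def tiltedLaw (α : ℝ) (g : PathSpace p d → ℝ≥0) (ν : Measure (PathSpace p d)) :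
    Measure (PathSpace p d) :=
  (ν.withDensity fun f => (g f : ℝ≥0∞) ^ α).map fun f => (g f)⁻¹ • f

theorem lintegral_tiltedLaw {g : PathSpace p d → ℝ≥0} (hg : Measurable g)
    (ν : Measure (PathSpace p d)) {G : PathSpace p d → ℝ≥0∞} (hG : Measurable G) :
    ∫⁻ f, G f ∂tiltedLaw α g ν = ∫⁻ f, (g f : ℝ≥0∞) ^ α * G ((g f)⁻¹ • f) ∂ν := by
  have hm : Measurable fun f : PathSpace p d => (g f)⁻¹ • f := PathSpace.measurable_smul hg.inv
  have hGm : Measurable fun f : PathSpace p d => G ((g f)⁻¹ • f) := hG.comp hm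
  rw [tiltedLaw, lintegral_map hG hm,
    lintegral_withDensity_eq_lintegral_mul _ (hg.coe_nnreal_ennreal.pow_const α) hGm]
  rfl

theorem IsHomogeneousFunctional.rpow_mul_map_inv_smul {H : PathSpace p d → ℝ≥0∞}
    (hH : IsHomogeneousFunctional α H) {c : ℝ≥0} (hc : 0 < c) (f : PathSpace p d) :
    (c : ℝ≥0∞) ^ α * H (c⁻¹ • f) = H f := by
  rw [← hH.map_smul c hc, smul_smul, mul_inv_cancel₀ hc.ne', one_smul]

/-- The density g^α exactly undoes the rescaling of `H` by 1/g where g > 0; where g = 0 the density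
vanishes because α > 0. -/
theorem IsHomogeneousFunctional.lintegral_tiltedLaw (hα : 0 < α) {H : PathSpace p d → ℝ≥0∞}
    (hH : IsHomogeneousFunctional α H) {g : PathSpace p d → ℝ≥0} (hg : Measurable g)
    (ν : Measure (PathSpace p d)) :
    ∫⁻ f, H f ∂tiltedLaw α g ν = ∫⁻ f in {f | 0 < g f}, H f ∂ν := by
  rw [_root_.lintegral_tiltedLaw hg ν hH.measurable,
    ← lintegral_indicator (measurableSet_lt measurable_const hg)]
  refine lintegral_congr fun f => ?_
  by_cases hf : 0 < g f
  · rw [Set.indicator_of_mem (by exact hf), hH.rpow_mul_map_inv_smul hf]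
  · rw [Set.indicator_of_notMem (by exact hf)]
    have : g f = 0 := by simpa using hf
    simp [this, hα]

end Tilting

/-! ### Exponent integrals determine all homogeneous integrals -/

section Determination

variable {p d : ℕ} {α : ℝ}

/-- The exponent is bounded by a finite sum of moments with nonzero denominators. Finiteness is what
permits subtracting integrals in the difference quotients. -/
theorem lintegral_scaledSup_ne_top (hα : 0 < α) {x : (Fin p → ℝ) → Fin d → ℝ≥0∞}
    (hx : IsFiniteLevel x) {ν : Measure (PathSpace p d)}
    (hν : ∀ t j, ∫⁻ f, (f t j : ℝ≥0∞) ^ α ∂ν ≠ ∞) : ∫⁻ f, scaledSup α x f ∂ν ≠ ∞ := by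
  have hle : ∀ f : PathSpace p d, scaledSup α x f ≤
      ∑ t ∈ hx.1.toFinset, ∑ j, (f t j : ℝ≥0∞) ^ α / x t j ^ α := by
    intro f
    rw [scaledSup_eq_biSup hα]
    refine iSup₂_le fun t ht => iSup_le fun j => ?_
    refine le_trans ?_ (Finset.single_le_sum (f := fun t => ∑ j, (f t j : ℝ≥0∞) ^ α / x t j ^ α)
      (fun _ _ => zero_le) (hx.1.mem_toFinset.2 ht))
    exact Finset.single_le_sum (f := fun j => (f t j : ℝ≥0∞) ^ α / x t j ^ α)
      (fun _ _ => zero_le) (Finset.mem_univ j)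
  have hm : ∀ t j, Measurable fun f : PathSpace p d => (f t j : ℝ≥0∞) ^ α / x t j ^ α :=
    fun t j => ((PathSpace.measurable_coord t j).pow_const α).div_const _
  refine ne_top_of_le_ne_top ?_ (lintegral_mono hle)
  rw [lintegral_finsetSum _ fun t _ => Finset.measurable_sum _ fun j _ => hm t j]
  refine ENNReal.sum_ne_top.2 fun t _ => ?_
  rw [lintegral_finsetSum _ fun j _ => hm t j]
  refine ENNReal.sum_ne_top.2 fun j _ => ?_
  simp only [div_eq_mul_inv]
  rw [lintegral_mul_const _ ((PathSpace.measurable_coord t j).pow_const α)]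
  refine ENNReal.mul_ne_top (hν t j) (ENNReal.inv_ne_top.2 ?_)
  simpa [hα, hα.le, hα.not_gt] using (hx.2 t j).ne'

/-- The difference quotients of `c ↦ max M (c Y)` at `1`. -/
theorem mul_max_sub_max_le {Y M : ℝ≥0∞} (n : ℕ) :
    ((n : ℝ≥0∞) + 1) * (max M ((1 + ((n : ℝ≥0∞) + 1)⁻¹) * Y) - max M Y) ≤ Y := by
  have hn : ((n : ℝ≥0∞) + 1) ≠ 0 := by simp
  have hn' : ((n : ℝ≥0∞) + 1) ≠ ∞ := by simp
  have h1 : max M ((1 + ((n : ℝ≥0∞) + 1)⁻¹) * Y) - max M Y ≤ ((n : ℝ≥0∞) + 1)⁻¹ * Y := by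
    rw [tsub_le_iff_left]
    refine max_le (le_max_left _ _ |>.trans le_self_add) ?_
    rw [add_mul, one_mul]
    gcongr
    exact le_max_right _ _
  calc _ ≤ ((n : ℝ≥0∞) + 1) * (((n : ℝ≥0∞) + 1)⁻¹ * Y) := by gcongr
    _ = Y := by rw [← mul_assoc, ENNReal.mul_inv_cancel hn hn', one_mul]

-- The quotient has step 1/(n+1). If M ≤ Y, both maxima are attained by the second argument and the
-- slope is Y; if M > Y, a small enough increase is invisible.
open Filter Topology in
theorem tendsto_mul_max_sub_max {Y M : ℝ≥0∞} (hY : Y ≠ ∞) :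
    Tendsto (fun n : ℕ => ((n : ℝ≥0∞) + 1) * (max M ((1 + ((n : ℝ≥0∞) + 1)⁻¹) * Y) - max M Y))
      atTop (𝓝 (if M ≤ Y then Y else 0)) := by
  split_ifs with h
  · refine tendsto_const_nhds.congr fun n => ?_
    have hn : ((n : ℝ≥0∞) + 1) ≠ 0 := by simp
    have hn' : ((n : ℝ≥0∞) + 1) ≠ ∞ := by simp
    have hmax : max M ((1 + ((n : ℝ≥0∞) + 1)⁻¹) * Y) = Y + ((n : ℝ≥0∞) + 1)⁻¹ * Y := by
      rw [add_mul, one_mul, max_eq_right (h.trans le_self_add)]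
    rw [max_eq_right h, hmax, ENNReal.add_sub_cancel_left hY, ← mul_assoc,
      ENNReal.mul_inv_cancel hn hn', one_mul]
  · rw [not_le] at h
    have hlim : Tendsto (fun n : ℕ => (1 + ((n : ℝ≥0∞) + 1)⁻¹) * Y) atTop (𝓝 ((1 + 0) * Y)) := by
      refine ENNReal.Tendsto.mul_const (Tendsto.const_add 1 ?_) (.inr hY)
      have := (tendsto_add_atTop_iff_nat 1).2 ENNReal.tendsto_inv_nat_nhds_zero
      simpa using this
    rw [add_zero, one_mul] at hlim
    refine tendsto_const_nhds.congr' ?_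
    filter_upwards [hlim.eventually_lt_const h] with n hn
    rw [max_eq_left hn.le, max_eq_left h.le, tsub_self, mul_zero]

/-- The term c f_j(t)^α is itself the exponent of the level that equals c^(-1/α) at (t, j) and ∞
elsewhere, so the maximum is the exponent of an infimum of levels. -/
theorem lintegral_max_scaledSup_eq (hα : 0 < α) {ν ν' : Measure (PathSpace p d)}
    (h : ∀ x, IsFiniteLevel x → ∫⁻ f, scaledSup α x f ∂ν = ∫⁻ f, scaledSup α x f ∂ν')
    {x : (Fin p → ℝ) → Fin d → ℝ≥0∞} (hx : IsFiniteLevel x) (t : Fin p → ℝ) (j : Fin d)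
    {c : ℝ≥0∞} (hc : c ≠ ∞) :
    ∫⁻ f, max (scaledSup α x f) (c * (f t j : ℝ≥0∞) ^ α) ∂ν =
      ∫⁻ f, max (scaledSup α x f) (c * (f t j : ℝ≥0∞) ^ α) ∂ν' := by
  classical
  have ha : 0 < c⁻¹ ^ α⁻¹ := ENNReal.rpow_pos_of_nonneg (ENNReal.inv_pos.2 hc) (by positivity)
  have hmax : ∀ f : PathSpace p d, max (scaledSup α x f) (c * (f t j : ℝ≥0∞) ^ α) =
      scaledSup α (x ⊓ Function.update ⊤ t (Function.update ⊤ j (c⁻¹ ^ α⁻¹))) f := by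
    intro f
    rw [scaledSup_inf hα, scaledSup_update hα, ENNReal.rpow_inv_rpow hα.ne', div_eq_mul_inv,
      inv_inv, mul_comm c]
  simp only [hmax]
  exact h _ (hx.inf (IsFiniteLevel.update t j ha))

-- Differentiation of c ↦ E[max(`scaledSup α x`, cY)] from the right at c = 1, with Y = f_j(t)^α;
-- the quotients are dominated by the integrable Y.
open Filter in
theorem lintegral_ite_scaledSup_le_eq (hα : 0 < α) {ν ν' : Measure (PathSpace p d)}
    (h : ∀ x, IsFiniteLevel x → ∫⁻ f, scaledSup α x f ∂ν = ∫⁻ f, scaledSup α x f ∂ν')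
    (hν : ∀ t j, ∫⁻ f, (f t j : ℝ≥0∞) ^ α ∂ν ≠ ∞) (hν' : ∀ t j, ∫⁻ f, (f t j : ℝ≥0∞) ^ α ∂ν' ≠ ∞)
    {x : (Fin p → ℝ) → Fin d → ℝ≥0∞} (hx : IsFiniteLevel x) (t : Fin p → ℝ) (j : Fin d) :
    ∫⁻ f, (if scaledSup α x f ≤ (f t j : ℝ≥0∞) ^ α then (f t j : ℝ≥0∞) ^ α else 0) ∂ν =
      ∫⁻ f, (if scaledSup α x f ≤ (f t j : ℝ≥0∞) ^ α then (f t j : ℝ≥0∞) ^ α else 0) ∂ν' := by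
  set Y : PathSpace p d → ℝ≥0∞ := fun f => (f t j : ℝ≥0∞) ^ α with hYdef
  have hY : Measurable Y := (PathSpace.measurable_coord t j).pow_const α
  have hM := measurable_scaledSup (p := p) (d := d) hα hx
  have hYtop : ∀ f, Y f ≠ ∞ := fun f => ENNReal.rpow_ne_top_of_nonneg hα.le ENNReal.coe_ne_top
  set D : ℕ → PathSpace p d → ℝ≥0∞ := fun n f =>
    ((n : ℝ≥0∞) + 1) * (max (scaledSup α x f) ((1 + ((n : ℝ≥0∞) + 1)⁻¹) * Y f) -
      max (scaledSup α x f) (Y f)) with hD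
  have hDm : ∀ n, Measurable (D n) := fun n =>
    ((hM.max (hY.const_mul _)).sub (hM.max hY)).const_mul _
  have hlim : ∀ m : Measure (PathSpace p d), ∫⁻ f, Y f ∂m ≠ ∞ →
      Tendsto (fun n => ∫⁻ f, D n f ∂m) atTop
        (nhds (∫⁻ f, (if scaledSup α x f ≤ Y f then Y f else 0) ∂m)) := fun m hm =>
    tendsto_lintegral_of_dominated_convergence Y hDm
      (fun n => .of_forall fun f => mul_max_sub_max_le n) hm
      (.of_forall fun f => tendsto_mul_max_sub_max (hYtop f))
  have hint : ∀ m : Measure (PathSpace p d), (∀ t j, ∫⁻ f, (f t j : ℝ≥0∞) ^ α ∂m ≠ ∞) →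
      ∀ n, ∫⁻ f, D n f ∂m = ((n : ℝ≥0∞) + 1) *
        (∫⁻ f, max (scaledSup α x f) ((1 + ((n : ℝ≥0∞) + 1)⁻¹) * Y f) ∂m -
          ∫⁻ f, max (scaledSup α x f) (1 * Y f) ∂m) := by
    intro m hm n
    have hfin : ∫⁻ f, max (scaledSup α x f) (Y f) ∂m ≠ ∞ := by
      refine ne_top_of_le_ne_top ?_ (lintegral_mono fun f => max_le_add_of_nonneg
        (zero_le) (zero_le))
      rw [lintegral_add_left hM]
      exact ENNReal.add_ne_top.2 ⟨lintegral_scaledSup_ne_top hα hx hm, hm t j⟩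
    simp only [hD, one_mul]
    rw [lintegral_const_mul' _ _ (by simp),
      lintegral_sub (hM.max hY) hfin (.of_forall fun f => max_le_max le_rfl ?_)]
    rw [add_mul, one_mul]
    exact le_self_add
  refine tendsto_nhds_unique (hlim ν (hν t j)) ((hlim ν' (hν' t j)).congr fun n => ?_)
  rw [hint ν hν, hint ν' hν',
    lintegral_max_scaledSup_eq hα h hx t j (c := 1 + ((n : ℝ≥0∞) + 1)⁻¹) (by simp),
    lintegral_max_scaledSup_eq hα h hx t j ENNReal.one_ne_top]

theorem measurable_coord_nnreal (t : Fin p → ℝ) (j : Fin d) :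
    Measurable fun f : PathSpace p d => f t j :=
  (measurable_pi_apply j).comp (PathSpace.measurable_eval t)

/-- The integrals of the exponents determine the laws tilted by a coordinate. -/
theorem tiltedLaw_coord_eq (hα : 0 < α) {ν ν' : Measure (PathSpace p d)}
    (h : ∀ x, IsFiniteLevel x → ∫⁻ f, scaledSup α x f ∂ν = ∫⁻ f, scaledSup α x f ∂ν')
    (hν : ∀ t j, ∫⁻ f, (f t j : ℝ≥0∞) ^ α ∂ν ≠ ∞) (hν' : ∀ t j, ∫⁻ f, (f t j : ℝ≥0∞) ^ α ∂ν' ≠ ∞)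
    (t : Fin p → ℝ) (j : Fin d) :
    tiltedLaw α (fun f => f t j) ν = tiltedLaw α (fun f => f t j) ν' := by
  have hm : Measurable fun f : PathSpace p d => (f t j)⁻¹ • f :=
    PathSpace.measurable_smul (measurable_coord_nnreal t j).inv
  refine PathSpace.measure_ext_of_map_pathEmb ?_
  have key : ∀ m : Measure (PathSpace p d), ∀ x, IsFiniteLevel x →
      (tiltedLaw α (fun f => f t j) m).map pathEmb (Set.Iic x) =
        ∫⁻ f, (if scaledSup α x f ≤ (f t j : ℝ≥0∞) ^ α then (f t j : ℝ≥0∞) ^ α else 0) ∂m := by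
    intro m x hx
    have hS : MeasurableSet (pathEmb ⁻¹' Set.Iic x : Set (PathSpace p d)) :=
      measurable_pathEmb hx.measurableSet_Iic
    rw [Measure.map_apply measurable_pathEmb hx.measurableSet_Iic, ← lintegral_indicator_one hS,
      lintegral_tiltedLaw (measurable_coord_nnreal t j) m (measurable_one.indicator hS)]
    refine lintegral_congr fun f => ?_
    rcases eq_zero_or_pos (f t j) with h0 | h0
    · simp [h0, hα]
    · have hne : (f t j : ℝ≥0∞) ^ α ≠ 0 := by simp [h0.ne']
      have hnt : (f t j : ℝ≥0∞) ^ α ≠ ∞ := ENNReal.rpow_ne_top_of_nonneg hα.le ENNReal.coe_ne_top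
      -- By homogeneity, the rescaled path lies below `x` exactly when the exponent of `f` is at
      -- most f_j(t)^α, which is the event produced by the derivative.
      have hiff : (f t j)⁻¹ • f ∈ pathEmb ⁻¹' Set.Iic x ↔
          scaledSup α x f ≤ (f t j : ℝ≥0∞) ^ α := by
        rw [Set.mem_preimage, Set.mem_Iic, ← scaledSup_le_one_iff hα,
          ← (isHomogeneousFunctional_scaledSup hα hx).rpow_mul_map_inv_smul h0 f,
          ENNReal.mul_le_iff_le_inv hne hnt, ENNReal.inv_mul_cancel hne hnt]
      by_cases hf : scaledSup α x f ≤ (f t j : ℝ≥0∞) ^ α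
      · rw [if_pos hf, Set.indicator_of_mem (hiff.2 hf), Pi.one_apply, mul_one]
      · rw [if_neg hf, Set.indicator_of_notMem (mt hiff.1 hf), mul_zero]
  have hfin : IsFiniteMeasure ((tiltedLaw α (fun f : PathSpace p d => f t j) ν).map pathEmb) := by
    have : IsFiniteMeasure (ν.withDensity fun f : PathSpace p d => (f t j : ℝ≥0∞) ^ α) :=
      isFiniteMeasure_withDensity (hν t j)
    unfold tiltedLaw
    infer_instance
  refine ext_of_Iic_isFiniteLevel fun x hx => ?_
  rw [key ν x hx, key ν' x hx, lintegral_ite_scaledSup_le_eq hα h hν hν' hx t j]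

theorem PathSpace.exists_ratPoint_pos (f : PathSpace p d) (hf : f ≠ 0) :
    ∃ i : (Fin p → ℚ) × Fin d, 0 < f (ratPoint i.1) i.2 := by
  by_contra hcon
  push Not at hcon
  refine hf (ContinuousMap.ext fun t => ?_)
  have hdense : DenseRange (ratPoint : (Fin p → ℚ) → _) :=
    DenseRange.piMap fun _ => Rat.denseRange_cast
  have := hdense.equalizer (map_continuous f) (continuous_const (y := (0 : Fin d → ℝ≥0)))
    (funext fun s => funext fun j => le_antisymm (hcon (s, j)) zero_le)
  exact congrFun this t

theorem PathSpace.measurableSet_ne_zero : MeasurableSet {f : PathSpace p d | f ≠ 0} := by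
  have : {f : PathSpace p d | f ≠ 0} =
      ⋃ i : (Fin p → ℚ) × Fin d, {f | 0 < f (ratPoint i.1) i.2} := by
    ext f
    simp only [Set.mem_ofPred_eq, Set.mem_iUnion]
    refine ⟨PathSpace.exists_ratPoint_pos f, ?_⟩
    rintro ⟨i, hi⟩ rfl
    simp at hi
  rw [this]
  exact MeasurableSet.iUnion fun i =>
    measurableSet_lt measurable_const (measurable_coord_nnreal _ _)

/-- The integrals of the exponents determine the integrals of all homogeneous functionals. -/
theorem lintegral_eq_of_lintegral_scaledSup_eq (hα : 0 < α) {ν ν' : Measure (PathSpace p d)}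
    (h : ∀ x, IsFiniteLevel x → ∫⁻ f, scaledSup α x f ∂ν = ∫⁻ f, scaledSup α x f ∂ν')
    (hν : ∀ t j, ∫⁻ f, (f t j : ℝ≥0∞) ^ α ∂ν ≠ ∞)
    (h0 : ∀ᵐ f ∂ν, f ≠ 0) (h0' : ∀ᵐ f ∂ν', f ≠ 0) {H : PathSpace p d → ℝ≥0∞}
    (hH : IsHomogeneousFunctional α H) : ∫⁻ f, H f ∂ν = ∫⁻ f, H f ∂ν' := by
  classical
  have hν' : ∀ t j, ∫⁻ f, (f t j : ℝ≥0∞) ^ α ∂ν' ≠ ∞ := by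
    intro t j
    -- The moment f_j(t)^α is the exponent of the level with the single constraint 1 at (t, j), so
    -- its finiteness transfers to `ν'`.
    have := h _ (IsFiniteLevel.update t j one_pos)
    simp only [scaledSup_update hα, ENNReal.one_rpow, div_one] at this
    rw [← this]
    exact hν t j
  refine lintegral_eq_of_forall_cone (ι := (Fin p → ℚ) × Fin d)
    (A := fun i => {f | 0 < f (ratPoint i.1) i.2})
    (fun i => measurableSet_lt measurable_const (measurable_coord_nnreal _ _))
    (fun i c hc f => ?_) (fun i G hG => ?_) hH
    (h0.mono fun f hf => .inl (PathSpace.exists_ratPoint_pos f hf))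
    (h0'.mono fun f hf => .inl (PathSpace.exists_ratPoint_pos f hf))
  · simp [hc]
  · rw [← hG.lintegral_tiltedLaw hα (measurable_coord_nnreal _ _),
      ← hG.lintegral_tiltedLaw hα (measurable_coord_nnreal _ _),
      tiltedLaw_coord_eq hα h hν hν']

end Determination

/-! ### The norm on ℝ^d and the converse part -/

section Norm

variable {p d : ℕ} {α : ℝ} {N : Seminorm ℝ (Fin d → ℝ)}

theorem measurable_normAt (N : Seminorm ℝ (Fin d → ℝ)) (t : Fin p → ℝ) :
    Measurable fun f : PathSpace p d => normAt N f t := by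
  have hN : Continuous N := continuousOn_univ.1 (N.convexOn.continuousOn isOpen_univ)
  refine Measurable.subtype_mk (hN.measurable.comp (measurable_pi_lambda _ fun j => ?_))
  exact (measurable_coord_nnreal t j).coe_nnreal_real

theorem normAt_smul (N : Seminorm ℝ (Fin d → ℝ)) (c : ℝ≥0) (f : PathSpace p d) (t : Fin p → ℝ) :
    normAt N (c • f) t = c * normAt N f t := by
  apply NNReal.eq
  have h : (fun j => (((c • f) t j : ℝ≥0) : ℝ)) = (c : ℝ) • fun j => (f t j : ℝ) := by
    ext j
    simp
  change N (fun j => (((c • f) t j : ℝ≥0) : ℝ)) = c * N fun j => (f t j : ℝ)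
  rw [h, map_smul_eq_mul, Real.norm_eq_abs, NNReal.abs_eq]

theorem normAt_eq_zero_of_eq_zero (N : Seminorm ℝ (Fin d → ℝ)) {f : PathSpace p d}
    {t : Fin p → ℝ} (h : f t = 0) : normAt N f t = 0 := by
  apply NNReal.eq
  change N (fun j => (f t j : ℝ)) = 0
  simp only [h, Pi.zero_apply, NNReal.coe_zero]
  exact map_zero N

theorem normAt_eq_zero_iff (hN : ∀ x, N x = 0 → x = 0) {f : PathSpace p d} {t : Fin p → ℝ} :
    normAt N f t = 0 ↔ f t = 0 := by
  refine ⟨fun h => ?_, normAt_eq_zero_of_eq_zero N⟩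
  have h2 : N (fun j => (f t j : ℝ)) = 0 := congrArg NNReal.toReal h
  ext j
  exact congrFun (hN _ h2) j

/-- Equivalence of norms: a definite `N` has a positive minimum on the compact unit sphere of the
sup norm. -/
theorem exists_coord_le_mul_normAt (hN : ∀ x, N x = 0 → x = 0) :
    ∃ C : ℝ≥0, ∀ (f : PathSpace p d) t j, f t j ≤ C * normAt N f t := by
  have hc : Continuous N := continuousOn_univ.1 (N.convexOn.continuousOn isOpen_univ)
  -- The sphere is empty only for d = 0, when there is no coordinate to bound.
  rcases (Metric.sphere (0 : Fin d → ℝ) 1).eq_empty_or_nonempty with he | hne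
  · refine ⟨0, fun f t j => ?_⟩
    exfalso
    have hj : Nonempty (Fin d) := ⟨j⟩
    have : (fun _ => 1 : Fin d → ℝ) ∈ Metric.sphere (0 : Fin d → ℝ) 1 := by simp
    rw [he] at this
    exact this
  · obtain ⟨x, hx, hmin⟩ := (isCompact_sphere (0 : Fin d → ℝ) 1).exists_isMinOn hne hc.continuousOn
    have hx1 : ‖x‖ = 1 := by simpa using hx
    have hpos : 0 < N x := lt_of_le_of_ne (apply_nonneg N x) fun h => by
      rw [hN x h.symm] at hx1
      simp at hx1
    have hbound : ∀ y, N x * ‖y‖ ≤ N y := by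
      intro y
      rcases eq_or_ne y 0 with rfl | hy
      · simp
      · have hy' : 0 < ‖y‖ := norm_pos_iff.2 hy
        have hmem : ‖y‖⁻¹ • y ∈ Metric.sphere (0 : Fin d → ℝ) 1 := by
          simp [norm_smul, hy'.ne']
        have h1 : N x ≤ N (‖y‖⁻¹ • y) := hmin hmem
        rw [map_smul_eq_mul, norm_inv, norm_norm] at h1
        rwa [← div_eq_inv_mul, le_div_iff₀ hy'] at h1
    refine ⟨⟨(N x)⁻¹, (inv_pos.2 hpos).le⟩, fun f t j => ?_⟩
    rw [← NNReal.coe_le_coe]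
    change (f t j : ℝ) ≤ (N x)⁻¹ * N fun j => (f t j : ℝ)
    rw [← div_eq_inv_mul, le_div_iff₀ hpos, mul_comm]
    refine le_trans ?_ (hbound _)
    gcongr
    have := norm_le_pi_norm (fun j => (f t j : ℝ)) j
    simpa using this

theorem lintegral_coord_ne_top (hN : ∀ x, N x = 0 → x = 0) (hα : 0 < α)
    {ν : Measure (PathSpace p d)} (hν : ∀ t, ∫⁻ f, (normAt N f t : ℝ≥0∞) ^ α ∂ν = 1)
    (t : Fin p → ℝ) (j : Fin d) : ∫⁻ f, (f t j : ℝ≥0∞) ^ α ∂ν ≠ ∞ := by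
  obtain ⟨C, hC⟩ := exists_coord_le_mul_normAt (p := p) hN
  have hle : ∀ f : PathSpace p d,
      (f t j : ℝ≥0∞) ^ α ≤ (C : ℝ≥0∞) ^ α * (normAt N f t : ℝ≥0∞) ^ α := fun f => by
    rw [← ENNReal.mul_rpow_of_nonneg _ _ hα.le]
    exact ENNReal.rpow_le_rpow (by exact_mod_cast hC f t j) hα.le
  refine ne_top_of_le_ne_top ?_ (lintegral_mono hle)
  rw [lintegral_const_mul _ ((measurable_normAt N t).coe_nnreal_ennreal.pow_const α), hν, mul_one]
  exact ENNReal.rpow_ne_top_of_nonneg hα.le ENNReal.coe_ne_top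

theorem HasUnitMoments.map {Ω : Type*} [MeasurableSpace Ω] {P : Measure Ω}
    {Z : Ω → PathSpace p d} (h : HasUnitMoments N α P Z) (hZ : Measurable Z) (t : Fin p → ℝ) :
    ∫⁻ f, (normAt N f t : ℝ≥0∞) ^ α ∂P.map Z = 1 := by
  rw [lintegral_map ((measurable_normAt N t).coe_nnreal_ennreal.pow_const α) hZ]
  exact h t

theorem IsNonvanishing.map {Ω : Type*} [MeasurableSpace Ω] {P : Measure Ω}
    {Z : Ω → PathSpace p d} (h : IsNonvanishing N P Z) (hZ : Measurable Z) :
    ∀ᵐ f ∂P.map Z, f ≠ 0 := by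
  rw [ae_map_iff hZ.aemeasurable PathSpace.measurableSet_ne_zero]
  filter_upwards [h] with ω hω h0
  rw [h0] at hω
  refine hω.ne' ?_
  simp only [ENNReal.iSup_eq_zero]
  intro t
  rw [normAt_eq_zero_of_eq_zero N rfl, ENNReal.coe_zero]

/-- If the tilted integrals of all `0`-homogeneous functionals agree, so do the max-stable laws. -/
theorem deHaanLaw_eq_of_tilted_eq (hN : ∀ x, N x = 0 → x = 0) (hα : 0 < α)
    {ν ν' : Measure (PathSpace p d)} [IsProbabilityMeasure ν] [IsProbabilityMeasure ν']
    (h : ∀ Γ : PathSpace p d → ℝ≥0∞, IsHomogeneousFunctional 0 Γ → ∀ t : Fin p → ℝ,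
      ∫⁻ f, (normAt N f t : ℝ≥0∞) ^ α * Γ f ∂ν = ∫⁻ f, (normAt N f t : ℝ≥0∞) ^ α * Γ f ∂ν') :
    deHaanLaw α ν = deHaanLaw α ν' := by
  refine (deHaanLaw_eq_iff hα ν ν').2 fun x hx => ?_
  have : Countable {t | x t ≠ ⊤} := hx.1.countable.to_subtype
  have hcover : ∀ f : PathSpace p d,
      (∃ i : {t | x t ≠ ⊤}, 0 < normAt N f i.1) ∨ scaledSup α x f = 0 := by
    intro f
    by_contra hcon
    rw [not_or, not_exists] at hcon
    refine hcon.2 (scaledSup_eq_zero hα fun t ht => ?_)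
    simpa [normAt_eq_zero_iff hN] using hcon.1 ⟨t, ht⟩
  refine lintegral_eq_of_forall_cone
    (A := fun i : {t | x t ≠ ⊤} => {f : PathSpace p d | 0 < normAt N f i.1})
    (fun i => measurableSet_lt measurable_const (measurable_normAt N _))
    (fun i c hc f => ?_) (fun i H hH => ?_) (isHomogeneousFunctional_scaledSup hα hx)
    (.of_forall fun f => hcover f) (.of_forall fun f => hcover f)
  · simp [normAt_smul, hc]
  · have hg : Measurable fun f : PathSpace p d => (normAt N f i.1 : ℝ≥0∞) ^ α :=
      (measurable_normAt N _).coe_nnreal_ennreal.pow_const α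
    -- Where the norm vanishes, the quotient is 0 or ∞. Homogeneity survives there, and the weight 0
    -- later removes the value.
    have hΓ : IsHomogeneousFunctional 0
        fun f : PathSpace p d => H f / (normAt N f i.1 : ℝ≥0∞) ^ α := by
      refine ⟨hH.measurable.div hg, fun c hc f => ?_⟩
      have hc0 : (c : ℝ≥0∞) ^ α ≠ 0 := by simp [hc.ne']
      have hct : (c : ℝ≥0∞) ^ α ≠ ∞ := ENNReal.rpow_ne_top_of_nonneg hα.le ENNReal.coe_ne_top
      rw [hH.map_smul c hc, normAt_smul, ENNReal.coe_mul, ENNReal.mul_rpow_of_nonneg _ _ hα.le,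
        ENNReal.mul_div_mul_left _ _ hc0 hct, ENNReal.rpow_zero, one_mul]
    have key : ∀ m : Measure (PathSpace p d), ∫⁻ f in {f | 0 < normAt N f i.1}, H f ∂m =
        ∫⁻ f, (normAt N f i.1 : ℝ≥0∞) ^ α * (H f / (normAt N f i.1 : ℝ≥0∞) ^ α) ∂m := by
      intro m
      rw [← lintegral_indicator (measurableSet_lt measurable_const (measurable_normAt N _))]
      refine lintegral_congr fun f => ?_
      by_cases hf : 0 < normAt N f i
      · rw [Set.indicator_of_mem (by exact hf), ENNReal.mul_div_cancel (by simp [hf.ne'])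
          (ENNReal.rpow_ne_top_of_nonneg hα.le ENNReal.coe_ne_top)]
      · rw [Set.indicator_of_notMem (by exact hf)]
        have : normAt N f i.1 = 0 := by simpa using hf
        simp [this, hα]
    rw [key, key, h _ hΓ]

/-- Processes with continuous paths and the same finite-dimensional distributions have the same
law. -/
theorem map_eq_of_map_coe_eq {Ω Ω' : Type*} [MeasurableSpace Ω] [MeasurableSpace Ω']
    {P : Measure Ω} {P' : Measure Ω'} {X : Ω → PathSpace p d} {X' : Ω' → PathSpace p d}
    (hX : Measurable X) (hX' : Measurable X')
    (h : P.map (fun ω t j => (X ω t j : ℝ≥0∞)) = P'.map (fun ω t j => (X' ω t j : ℝ≥0∞))) :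
    P.map X = P'.map X' := by
  refine PathSpace.measure_ext_of_map_pathEmb ?_
  rw [Measure.map_map measurable_pathEmb hX, Measure.map_map measurable_pathEmb hX']
  exact h

end Norm

/-! ### The normalising sum and the tilted process at a random index -/

section Normalisation

variable {p d : ℕ} {α : ℝ} {N : Seminorm ℝ (Fin d → ℝ)} {q : PMF (Fin p → ℚ)}

theorem measurable_weightedSum : Measurable (weightedSum (p := p) N α q) :=
  Measurable.tsum fun _ =>
    ((measurable_normAt N _).coe_nnreal_ennreal.pow_const α).mul_const _

theorem measurable_normalisedPath : Measurable (normalisedPath (p := p) N α q) :=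
  PathSpace.measurable_smul
    ((measurable_weightedSum.ennreal_toNNReal.pow_const (1 / α)).inv)

theorem weightedSum_smul (hα : 0 < α) (c : ℝ≥0) (f : PathSpace p d) :
    weightedSum N α q (c • f) = (c : ℝ≥0∞) ^ α * weightedSum N α q f := by
  simp only [weightedSum, ← ENNReal.tsum_mul_left, normAt_smul, ENNReal.coe_mul,
    ENNReal.mul_rpow_of_nonneg _ _ hα.le, mul_assoc]

theorem normalisedPath_smul (hα : 0 < α) {c : ℝ≥0} (hc : 0 < c) (f : PathSpace p d) :
    normalisedPath N α q (c • f) = normalisedPath N α q f := by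
  rw [normalisedPath, normalisedPath, weightedSum_smul hα, ENNReal.toNNReal_mul,
    ENNReal.toNNReal_rpow, ENNReal.toNNReal_coe, NNReal.mul_rpow, ← NNReal.rpow_mul,
    mul_one_div_cancel hα.ne', NNReal.rpow_one, mul_inv, smul_smul, mul_right_comm,
    inv_mul_cancel₀ hc.ne', one_mul]

theorem IsHomogeneousFunctional.map_normalisedPath (hα : 0 < α) {H : PathSpace p d → ℝ≥0∞}
    (hH : IsHomogeneousFunctional α H) {f : PathSpace p d} (h0 : 0 < weightedSum N α q f)
    (htop : weightedSum N α q f < ∞) :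
    weightedSum N α q f * H (normalisedPath N α q f) = H f := by
  have hS : (((weightedSum N α q f).toNNReal ^ (1 / α) : ℝ≥0) : ℝ≥0∞) ^ α =
      weightedSum N α q f := by
    rw [ENNReal.coe_rpow_of_nonneg _ (by positivity), ENNReal.coe_toNNReal htop.ne,
      ← ENNReal.rpow_mul, one_div_mul_cancel hα.ne', ENNReal.rpow_one]
  have hpos : 0 < (weightedSum N α q f).toNNReal ^ (1 / α) :=
    NNReal.rpow_pos (ENNReal.toNNReal_pos h0.ne' htop.ne)
  have := hH.rpow_mul_map_inv_smul hpos f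
  rwa [hS] at this

theorem weightedSum_pos (hN : ∀ x, N x = 0 → x = 0) (hq : ∀ s, 0 < q s)
    {f : PathSpace p d} (hf : f ≠ 0) : 0 < weightedSum N α q f := by
  obtain ⟨⟨s, j⟩, hs⟩ := PathSpace.exists_ratPoint_pos f hf
  refine lt_of_lt_of_le ?_ (ENNReal.le_tsum s)
  have h1 : normAt N f (ratPoint s) ≠ 0 := by
    rw [Ne, normAt_eq_zero_iff hN]
    intro h
    simp [h] at hs
  refine ENNReal.mul_pos ?_ (hq s).ne'
  simp [h1]

/-- By Tonelli the weighted sum has integral ∑ q(s) = 1. -/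
theorem ae_weightedSum_lt_top {ν : Measure (PathSpace p d)}
    (hν : ∀ t, ∫⁻ f, (normAt N f t : ℝ≥0∞) ^ α ∂ν = 1) :
    ∀ᵐ f ∂ν, weightedSum N α q f < ∞ := by
  refine ae_lt_top measurable_weightedSum ?_
  have hm : ∀ t : Fin p → ℝ, Measurable fun f : PathSpace p d => (normAt N f t : ℝ≥0∞) ^ α :=
    fun t => (measurable_normAt N _).coe_nnreal_ennreal.pow_const α
  simp only [weightedSum]
  rw [lintegral_tsum fun s => ((hm _).mul_const _).aemeasurable]
  simp [lintegral_mul_const _ (hm _), hν, q.tsum_coe]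

theorem IsTiltedProcess.lintegral_comp {Ω Ω' : Type*} [MeasurableSpace Ω] [MeasurableSpace Ω']
    {P : Measure Ω} {P' : Measure Ω'} {Z : Ω → PathSpace p d} {Y : Ω' → PathSpace p d}
    {h : Fin p → ℝ} (hY : IsTiltedProcess N α h P Z P' Y) (hZ : Measurable Z)
    (hZ1 : HasUnitMoments N α P Z) {G : PathSpace p d → ℝ≥0∞} (hG : Measurable G) :
    ∫⁻ ω, G (Y ω) ∂P' =
      ∫⁻ f, (normAt N f h : ℝ≥0∞) ^ α * G ((normAt N f h)⁻¹ • f) ∂P.map Z := by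
  have hlaw : P'.map Y = tiltedLaw α (fun f => normAt N f h) (P.map Z) := by
    ext A hA
    rw [Measure.map_apply hY.measurable hA, hY.law A hA, hZ1 h, inv_one, one_mul,
      ← lintegral_indicator_one hA, lintegral_tiltedLaw (measurable_normAt N h) _
        (measurable_one.indicator hA)]
    have hm : Measurable fun f : PathSpace p d => (normAt N f h : ℝ≥0∞) ^ α *
        A.indicator 1 ((normAt N f h)⁻¹ • f) :=
      ((measurable_normAt N h).coe_nnreal_ennreal.pow_const α).mul
        ((measurable_one.indicator hA).comp
          (PathSpace.measurable_smul (measurable_normAt N h).inv))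
    rw [lintegral_map hm hZ]
    rfl
  rw [← lintegral_map hG hY.measurable, hlaw, lintegral_tiltedLaw (measurable_normAt N h) _ hG]

/-- Countability of ℚ^p gives joint measurability in the index and ω; no regularity of Θ^{[h]} in h
is involved. -/
theorem measurable_randomIndex {Ω : Type*} [MeasurableSpace Ω]
    {Θ : (Fin p → ℝ) → Ω → PathSpace p d} {W : Ω → (Fin p → ℚ)} (hΘ : ∀ h, Measurable (Θ h))
    (hW : Measurable W) : Measurable fun ω => Θ (ratPoint (W ω)) ω := by
  have : Measurable fun y : (Fin p → ℚ) × Ω => Θ (ratPoint y.1) y.2 :=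
    measurable_from_prod_countable_right fun s => hΘ (ratPoint s)
  exact this.comp (hW.prodMk measurable_id)

/-- The law of the tilted process at an independent random index. -/
theorem lintegral_randomIndex {Ω Ω' : Type*} [MeasurableSpace Ω] [MeasurableSpace Ω']
    {P : Measure Ω} {P' : Measure Ω'} [IsProbabilityMeasure P'] {Z : Ω → PathSpace p d}
    (hZ : Measurable Z) (hZ1 : HasUnitMoments N α P Z)
    {Θ : (Fin p → ℝ) → Ω' → PathSpace p d} {W : Ω' → (Fin p → ℚ)}
    (hΘ : ∀ h, IsTiltedProcess N α h P Z P' (Θ h)) (hW : Measurable W)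
    (hWq : P'.map W = q.toMeasure) (hind : IndepFun W (fun ω h => Θ h ω) P')
    {G : PathSpace p d → ℝ≥0∞} (hG : Measurable G) :
    ∫⁻ ω, G (Θ (ratPoint (W ω)) ω) ∂P' =
      ∑' s, q s * ∫⁻ f, (normAt N f (ratPoint s) : ℝ≥0∞) ^ α *
        G ((normAt N f (ratPoint s))⁻¹ • f) ∂P.map Z := by
  -- Decomposition over the values of `W`; independence then factors each term into q(s) and an
  -- expectation of Θ^{[s]}.
  have hsplit : ∀ ω, G (Θ (ratPoint (W ω)) ω) =
      ∑' s, ({s} : Set (Fin p → ℚ)).indicator 1 (W ω) * G (Θ (ratPoint s) ω) := by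
    intro ω
    rw [tsum_eq_single (W ω)]
    · simp
    · intro s hs
      rw [Set.indicator_of_notMem (by simpa using hs.symm), zero_mul]
  have hI : ∀ s : Fin p → ℚ,
      Measurable (({s} : Set (Fin p → ℚ)).indicator (1 : (Fin p → ℚ) → ℝ≥0∞)) :=
    fun s => measurable_one.indicator (measurableSet_singleton s)
  have hGΘ : ∀ s : Fin p → ℚ, Measurable fun ω => G (Θ (ratPoint s) ω) :=
    fun s => hG.comp (hΘ (ratPoint s)).measurable
  simp only [hsplit]
  have hIW : ∀ s, Measurable fun ω =>
      ({s} : Set (Fin p → ℚ)).indicator (1 : (Fin p → ℚ) → ℝ≥0∞) (W ω) :=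
    fun s => (hI s).comp hW
  rw [lintegral_tsum fun s => ((hIW s).fun_mul (hGΘ s)).aemeasurable]
  refine tsum_congr fun s => ?_
  have hind' : IndepFun (fun ω => ({s} : Set (Fin p → ℚ)).indicator (1 : (Fin p → ℚ) → ℝ≥0∞) (W ω))
      (fun ω => G (Θ (ratPoint s) ω)) P' :=
    hind.comp (ψ := fun θ : (Fin p → ℝ) → PathSpace p d => G (θ (ratPoint s))) (hI s)
      (hG.comp (measurable_pi_apply _))
  have h1 := lintegral_mul_eq_lintegral_mul_lintegral_of_indepFun (hIW s) (hGΘ s) hind'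
  have h2 : ∫⁻ ω, ({s} : Set (Fin p → ℚ)).indicator (1 : (Fin p → ℚ) → ℝ≥0∞) (W ω) ∂P' = q s := by
    rw [← lintegral_map (hI s) hW, hWq, lintegral_indicator_one (measurableSet_singleton s),
      PMF.toMeasure_apply_singleton _ _ (measurableSet_singleton s)]
  rw [← (hΘ (ratPoint s)).lintegral_comp hZ hZ1 hG, ← h2]
  exact h1

end Normalisation

/-! ### Homogeneous integrals of the normalised process -/

section RandomIndex

variable {p d : ℕ} {α : ℝ} {N : Seminorm ℝ (Fin d → ℝ)} {q : PMF (Fin p → ℚ)}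
  {Ω Ω' : Type*} [MeasurableSpace Ω] [MeasurableSpace Ω'] {P : Measure Ω} {P' : Measure Ω'}
  [IsProbabilityMeasure P'] {Z : Ω → PathSpace p d} {Θ : (Fin p → ℝ) → Ω' → PathSpace p d}
  {W : Ω' → (Fin p → ℚ)}

theorem ae_weightedSum_randomIndex (hN : ∀ x, N x = 0 → x = 0) (hα : 0 < α)
    (hZ : Measurable Z) (hZ1 : HasUnitMoments N α P Z) (hZ0 : IsNonvanishing N P Z)
    (hΘ : ∀ h, IsTiltedProcess N α h P Z P' (Θ h)) (hW : Measurable W)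
    (hWq : P'.map W = q.toMeasure) (hq : ∀ s, 0 < q s)
    (hind : IndepFun W (fun ω h => Θ h ω) P') :
    ∀ᵐ ω ∂P', 0 < weightedSum N α q (Θ (ratPoint (W ω)) ω) ∧
      weightedSum N α q (Θ (ratPoint (W ω)) ω) < ∞ := by
  set A : Set (PathSpace p d) := {f | 0 < weightedSum N α q f ∧ weightedSum N α q f < ∞} with hAdef
  have hA : MeasurableSet A :=
    (measurableSet_lt measurable_const measurable_weightedSum).inter
      (measurableSet_lt measurable_weightedSum measurable_const)
  have hG : Measurable (Aᶜ.indicator (1 : PathSpace p d → ℝ≥0∞)) :=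
    measurable_one.indicator hA.compl
  have hGΘ : Measurable fun ω => Aᶜ.indicator (1 : PathSpace p d → ℝ≥0∞) (Θ (ratPoint (W ω)) ω) :=
    hG.comp (measurable_randomIndex (fun h => (hΘ h).measurable) hW)
  have hzero : ∫⁻ ω, Aᶜ.indicator (1 : PathSpace p d → ℝ≥0∞) (Θ (ratPoint (W ω)) ω) ∂P' = 0 := by
    rw [lintegral_randomIndex hZ hZ1 hΘ hW hWq hind hG, ENNReal.tsum_eq_zero]
    refine fun s => mul_eq_zero_of_right _ (lintegral_eq_zero_of_ae_eq_zero ?_)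
    filter_upwards [hZ0.map hZ, ae_weightedSum_lt_top (q := q) (hZ1.map hZ)] with f hf hf'
    rcases eq_zero_or_pos (normAt N f (ratPoint s)) with h0 | h0
    · simp [h0, hα]
    · have hc : 0 < ((normAt N f (ratPoint s))⁻¹ : ℝ≥0) := inv_pos.2 h0
      -- A positive scaling multiplies the weighted sum by a positive finite factor, so the property
      -- passes from Z to its tilted versions.
      have hmem : (normAt N f (ratPoint s))⁻¹ • f ∈ A := by
        simp only [hAdef, Set.mem_ofPred_eq, weightedSum_smul hα]
        exact ⟨ENNReal.mul_pos (by simp [h0.ne']) (weightedSum_pos hN hq hf).ne',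
          ENNReal.mul_lt_top (ENNReal.rpow_lt_top_of_nonneg hα.le ENNReal.coe_ne_top) hf'⟩
      rw [Set.indicator_of_notMem (by simpa using hmem), mul_zero, Pi.zero_apply]
  rw [lintegral_eq_zero_iff hGΘ] at hzero
  filter_upwards [hzero] with ω hω
  by_contra h
  have : Aᶜ.indicator (1 : PathSpace p d → ℝ≥0∞) (Θ (ratPoint (W ω)) ω) = 0 := hω
  rw [Set.indicator_of_mem (by exact h)] at this
  simp at this

/-- The integrals of `α`-homogeneous functionals are unchanged on passing from `Z` to the
normalised tilted process at a random index. -/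
theorem IsHomogeneousFunctional.lintegral_normalisedPath_randomIndex
    (hN : ∀ x, N x = 0 → x = 0) (hα : 0 < α)
    (hZ : Measurable Z) (hZ1 : HasUnitMoments N α P Z) (hZ0 : IsNonvanishing N P Z)
    (hΘ : ∀ h, IsTiltedProcess N α h P Z P' (Θ h)) (hW : Measurable W)
    (hWq : P'.map W = q.toMeasure) (hq : ∀ s, 0 < q s)
    (hind : IndepFun W (fun ω h => Θ h ω) P') {H : PathSpace p d → ℝ≥0∞}
    (hH : IsHomogeneousFunctional α H) :
    ∫⁻ ω, H (normalisedPath N α q (Θ (ratPoint (W ω)) ω)) ∂P' = ∫⁻ f, H f ∂P.map Z := by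
  have hG : Measurable fun f : PathSpace p d => H (normalisedPath N α q f) :=
    hH.measurable.comp measurable_normalisedPath
  have hm : ∀ s : Fin p → ℚ,
      Measurable fun f : PathSpace p d => (normAt N f (ratPoint s) : ℝ≥0∞) ^ α :=
    fun s => (measurable_normAt N _).coe_nnreal_ennreal.pow_const α
  -- The normalised path is invariant under positive scaling, so division by ‖f(s)‖ disappears; the
  -- sum over s of the remaining weights is then `weightedSum`.
  have hterm : ∀ (s : Fin p → ℚ) (f : PathSpace p d), (normAt N f (ratPoint s) : ℝ≥0∞) ^ α *
      H (normalisedPath N α q ((normAt N f (ratPoint s))⁻¹ • f)) =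
      (normAt N f (ratPoint s) : ℝ≥0∞) ^ α * H (normalisedPath N α q f) := by
    intro s f
    rcases eq_zero_or_pos (normAt N f (ratPoint s)) with h0 | h0
    · simp [h0, hα]
    · rw [normalisedPath_smul hα (inv_pos.2 h0)]
  rw [lintegral_randomIndex hZ hZ1 hΘ hW hWq hind hG]
  simp only [hterm]
  have hswap : ∀ s, q s * ∫⁻ f, (normAt N f (ratPoint s) : ℝ≥0∞) ^ α *
        H (normalisedPath N α q f) ∂P.map Z =
      ∫⁻ f, (normAt N f (ratPoint s) : ℝ≥0∞) ^ α * q s * H (normalisedPath N α q f) ∂P.map Z := by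
    intro s
    rw [← lintegral_const_mul _ ((hm s).fun_mul hG)]
    exact lintegral_congr fun f => by ring
  simp only [hswap]
  rw [← lintegral_tsum fun s => (((hm s).mul_const _).fun_mul hG).aemeasurable]
  refine lintegral_congr_ae ?_
  filter_upwards [hZ0.map hZ, ae_weightedSum_lt_top (q := q) (hZ1.map hZ)] with f hf hf'
  rw [ENNReal.tsum_mul_right]
  exact hH.map_normalisedPath hα (weightedSum_pos hN hq hf) hf'

end RandomIndex

/-! ### The theorem -/

theorem mainTheorem1 {p d : ℕ}
    (N : Seminorm ℝ (Fin d → ℝ)) (hN : ∀ x, N x = 0 → x = 0)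
    {α : ℝ} (hα : 0 < α)
    {Ω Ω₁ Ω₂ Ω₃ Ω₄ : Type*} [MeasurableSpace Ω] [MeasurableSpace Ω₁] [MeasurableSpace Ω₂]
    [MeasurableSpace Ω₃] [MeasurableSpace Ω₄]
    -- the process `Z`, with `E[‖Z(t)‖^α] = 1` for all `t`, and another process `Z'`
    (P : Measure Ω) [IsProbabilityMeasure P]
    (Z : Ω → PathSpace p d) (hZ : Measurable Z) (hZ1 : HasUnitMoments N α P Z)
    (P₁ : Measure Ω₁) [IsProbabilityMeasure P₁]
    (Z' : Ω₁ → PathSpace p d) (hZ' : Measurable Z')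
    -- processes `X` and `X'` with sample paths in `C`
    (P₂ : Measure Ω₂) [IsProbabilityMeasure P₂] (X : Ω₂ → PathSpace p d)
    (P₃ : Measure Ω₃) [IsProbabilityMeasure P₃] (X' : Ω₃ → PathSpace p d)
    -- the tilted processes `Θ^{[h]}` and a `ℚ^p`-valued random index `W`, on one space
    (P₄ : Measure Ω₄) [IsProbabilityMeasure P₄]
    (Θ : (Fin p → ℝ) → Ω₄ → PathSpace p d) (W : Ω₄ → (Fin p → ℚ)) (q : PMF (Fin p → ℚ)) :
    -- (i), direct part
    (IsSpectralProcess α P Z P₂ X → IsNonvanishing N P Z →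
      IsSpectralProcess α P₁ Z' P₂ X → IsNonvanishing N P₁ Z' →
      ∀ H : PathSpace p d → ℝ≥0∞, IsHomogeneousFunctional α H →
        ∫⁻ ω, H (Z ω) ∂P = ∫⁻ ω, H (Z' ω) ∂P₁) ∧
    -- (i), converse part
    (HasUnitMoments N α P₁ Z' →
      (∀ Γ : PathSpace p d → ℝ≥0∞, IsHomogeneousFunctional 0 Γ → ∀ h : Fin p → ℝ,
        ∫⁻ ω, (normAt N (Z ω) h : ℝ≥0∞) ^ α * Γ (Z ω) ∂P =
          ∫⁻ ω, (normAt N (Z' ω) h : ℝ≥0∞) ^ α * Γ (Z' ω) ∂P₁) →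
      deHaanLaw α (P.map Z) = deHaanLaw α (P₁.map Z') ∧
      (IsSpectralProcess α P Z P₂ X → IsSpectralProcess α P₁ Z' P₃ X' →
        P₂.map X = P₃.map X')) ∧
    -- (ii)
    (IsSpectralProcess α P Z P₂ X → IsNonvanishing N P Z →
      (∀ h : Fin p → ℝ, IsTiltedProcess N α h P Z P₄ (Θ h)) →
      Measurable W → P₄.map W = q.toMeasure → (∀ s, 0 < q s) →
      IndepFun W (fun ω h => Θ h ω) P₄ →
      (∀ᵐ ω ∂P₄, 0 < weightedSum N α q (Θ (ratPoint (W ω)) ω) ∧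
        weightedSum N α q (Θ (ratPoint (W ω)) ω) < ∞) ∧
      IsSpectralProcess α P₄ (fun ω => normalisedPath N α q (Θ (ratPoint (W ω)) ω)) P₂ X) := by
  have hν : IsProbabilityMeasure (P.map Z) := Measure.isProbabilityMeasure_map hZ.aemeasurable
  have hν' : IsProbabilityMeasure (P₁.map Z') :=
    Measure.isProbabilityMeasure_map hZ'.aemeasurable
  refine ⟨fun hX hZ0 hX' hZ0' H hH => ?_, fun _ hΓ => ?_, fun hX hZ0 hΘ hW hWq hq hind => ?_⟩
  · have hlaw : deHaanLaw α (P.map Z) = deHaanLaw α (P₁.map Z') :=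
      hX.law_eq.symm.trans hX'.law_eq
    rw [← lintegral_map hH.measurable hZ, ← lintegral_map hH.measurable hZ']
    exact lintegral_eq_of_lintegral_scaledSup_eq hα ((deHaanLaw_eq_iff hα _ _).1 hlaw)
      (lintegral_coord_ne_top hN hα (hZ1.map hZ)) (hZ0.map hZ) (hZ0'.map hZ') hH
  · have hlaw : deHaanLaw α (P.map Z) = deHaanLaw α (P₁.map Z') := by
      refine deHaanLaw_eq_of_tilted_eq hN hα fun Γ hΓ0 t => ?_
      have hm : Measurable fun f : PathSpace p d => (normAt N f t : ℝ≥0∞) ^ α * Γ f :=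
        ((measurable_normAt N t).coe_nnreal_ennreal.pow_const α).mul hΓ0.measurable
      rw [lintegral_map hm hZ, lintegral_map hm hZ']
      exact hΓ Γ hΓ0 t
    refine ⟨hlaw, fun hX hX' => map_eq_of_map_coe_eq hX.measurable_process
      hX'.measurable_process ?_⟩
    rw [hX.law_eq, hX'.law_eq, hlaw]
  · refine ⟨ae_weightedSum_randomIndex hN hα hZ hZ1 hZ0 hΘ hW hWq hq hind, ?_⟩
    have hm : Measurable fun ω => normalisedPath N α q (Θ (ratPoint (W ω)) ω) :=
      measurable_normalisedPath.comp (measurable_randomIndex (fun h => (hΘ h).measurable) hW)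
    have := Measure.isProbabilityMeasure_map (μ := P₄) hm.aemeasurable
    refine ⟨hm, hX.measurable_process, hX.law_eq.trans ?_⟩
    refine (deHaanLaw_eq_iff hα _ _).2 fun x hx => ?_
    -- Exponents are α-homogeneous, so their expectations are the same for Z and Z_W, which is all
    -- that equality of the max-stable laws requires.
    have hH := isHomogeneousFunctional_scaledSup (p := p) (d := d) hα hx
    rw [lintegral_map hH.measurable hm]
    exact (hH.lintegral_normalisedPath_randomIndex hN hα hZ hZ1 hZ0 hΘ hW hWq hq hind).symm
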